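/- A Clifford circuit on $n$ qubits is a finite sequence of gates from $\{H, S, \mathrm{CNOT}\}$; a CNOT circuit is one all of whose gates are CNOT gates. Consider two processors $A$ and $B$. The $n$ input qubits are placed by a partition $\pi:[n]\to\{A,B\}$, and each processor has $m$ further (ancilla) qubits. A two-processor circuit is a finite sequence of gates, each of which is either an arbitrary unitary on the qubits of one processor (cost $0$) or a nonlocal gate, i.e. an arbitrary two-qubit unitary on one qubit of $A$ and one qubit of $B$ (cost $1$). It implements an $n$-qubit unitary $U$ if it maps $|\psi\rangle|0\cdots0\rangle$ to $(U|\psi\rangle)|0\cdots0\rangle$ for every state $|\psi\rangle$ of the input qubits, all ancilla qubits being in state $|0\rangle$ before and after. For a constant $c\ge 1/2$, call $\pi$ $c$-balanced if $\bigl||\pi^{-1}(p)|-n/2\bigr|\le c$ for $p\in\{A,B\}$. Let $\mathcal C_m^{(c)}(U)$ be the minimum number of nonlocal gates, over all $c$-balanced partitions $\pi$ and all two-processor circuits that implement $U$, and let $\mathcal C_\infty^{(c)}(U)=\inf_{m\ge 0}\mathcal C_m^{(c)}(U)$. For a circuit $T$, write $\mathcal C_m^{(c)}(T)$ for the value at the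 unitary computed by $T$. **Theorem.** (i) For every $c\ge 1/2$, every $n\ge 0$ and every $n$-qubit Clifford circuit $T$, $\mathcal C_1^{(c)}(T)\le 10n$. (ii) There are a constant $K>0$ and, for every $n$, an $n$-qubit CNOT circuit (in particular, a Clifford circuit) $T_n$, such that for every $c\ge 1/2$ there is an $N$ with $\mathcal C_\infty^{(c)}(T_n)\ge n/K$ for all $n\ge N$. That is, $\mathcal C_\infty(T_n)=\Omega(n)$ even with unbounded ancillas. -/

import Mathlib

/-- Operators on the register with qubit set `ι`, as matrices in the computational basis. -/
abbrev QubitOp (ι : Type) : Type := Matrix (ι → Bool) (ι → Bool) ℂ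

/-- The operator on the register `ι` that applies `V` to the qubits `f k` (`k : κ`) and the
identity to all other qubits. The map `f` is injective wherever this is used. -/
def onQubits {ι κ : Type} [Fintype ι] [Fintype κ] [DecidableEq ι] [DecidableEq κ]
    (f : κ → ι) (V : QubitOp κ) : QubitOp ι :=
  fun x y => if ∀ i : ι, (∀ k : κ, f k ≠ i) → x i = y i then V (x ∘ f) (y ∘ f) else 0

/-! ### Clifford circuits -/

/-- The Hadamard gate. -/
noncomputable def hadamardOp : QubitOp (Fin 1) :=
  fun x y => ((1 / Real.sqrt 2 : ℝ) : ℂ) * (if x 0 = true ∧ y 0 = true then -1 else 1)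

/-- The phase gate `S = diag(1, i)`. -/
noncomputable def phaseOp : QubitOp (Fin 1) :=
  fun x y => if x = y then (if y 0 = true then Complex.I else 1) else 0

/-- The gate `CNOT |u, v⟩ = |u, u ⊕ v⟩`. -/
def cnotOp : QubitOp (Fin 2) :=
  fun x y => if x 0 = y 0 ∧ x 1 = Bool.xor (y 0) (y 1) then 1 else 0

/-- A gate of the set `{H, S, CNOT}`, placed on qubits of an `n`-qubit register. -/
inductive CliffordGate (n : ℕ) : Type
  | hadamard (i : Fin n) : CliffordGate n
  | phase (i : Fin n) : CliffordGate n
  | cnot (control target : Fin n) (hne : control ≠ target) : CliffordGate n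

/-- The `n`-qubit unitary of a placed gate. -/
noncomputable def CliffordGate.op {n : ℕ} : CliffordGate n → QubitOp (Fin n)
  | .hadamard i => onQubits ![i] hadamardOp
  | .phase i => onQubits ![i] phaseOp
  | .cnot i j _ => onQubits ![i, j] cnotOp

/-- An `n`-qubit Clifford circuit: a finite sequence of gates, the head being applied first. -/
abbrev CliffordCircuit (n : ℕ) : Type := List (CliffordGate n)

/-- The `n`-qubit unitary of a Clifford circuit. -/
noncomputable def CliffordCircuit.op {n : ℕ} : CliffordCircuit n → QubitOp (Fin n)
  | [] => 1
  | g :: T => CliffordCircuit.op T * g.op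

/-- A CNOT circuit: all of its gates are CNOT gates. -/
def CliffordCircuit.IsCNOT {n : ℕ} (T : CliffordCircuit n) : Prop :=
  ∀ g ∈ T, ∃ (i j : Fin n) (hne : i ≠ j), g = CliffordGate.cnot i j hne

/-! ### Circuits on two processors -/

/-- All qubits present: the `n` input qubits, and `m` ancilla qubits for each processor. -/
abbrev DistQubit (n m : ℕ) : Type := Fin n ⊕ (Fin 2 × Fin m)

/-- The processor that holds a qubit, if the input qubits are placed according to `π`. -/
def processorOf {n : ℕ} (m : ℕ) (π : Fin n → Fin 2) : DistQubit n m → Fin 2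
  | .inl i => π i
  | .inr a => a.1

/-- A gate of a two-processor circuit: an arbitrary unitary on all the qubits of one processor,
or a nonlocal gate, that is, an arbitrary unitary on two qubits of different processors. -/
inductive DistGate {n : ℕ} (m : ℕ) (π : Fin n → Fin 2) : Type
  | onProcessor (p : Fin 2)
      (V : Matrix.unitaryGroup ({q : DistQubit n m // processorOf m π q = p} → Bool) ℂ) :
      DistGate m π
  | nonlocal (q r : DistQubit n m) (hne : processorOf m π q ≠ processorOf m π r)
      (V : Matrix.unitaryGroup (Fin 2 → Bool) ℂ) : DistGate m π

/-- The unitary of a gate on the whole register. -/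
def DistGate.op {n m : ℕ} {π : Fin n → Fin 2} : DistGate m π → QubitOp (DistQubit n m)
  | .onProcessor _ V => onQubits Subtype.val V.1
  | .nonlocal q r _ V => onQubits ![q, r] V.1

/-- The number of nonlocal two-qubit gates that a gate contributes. -/
def DistGate.cost {n m : ℕ} {π : Fin n → Fin 2} : DistGate m π → ℕ
  | .onProcessor _ _ => 0
  | .nonlocal _ _ _ _ => 1

/-- A two-processor circuit: a finite sequence of gates, the head being applied first. -/
abbrev DistCircuit {n : ℕ} (m : ℕ) (π : Fin n → Fin 2) : Type := List (DistGate m π)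

/-- The unitary of a two-processor circuit on the whole register. -/
noncomputable def DistCircuit.op {n m : ℕ} {π : Fin n → Fin 2} :
    DistCircuit m π → QubitOp (DistQubit n m)
  | [] => 1
  | g :: C => DistCircuit.op C * g.op

/-- The number of nonlocal two-qubit gates in a two-processor circuit. -/
def DistCircuit.cost {n m : ℕ} {π : Fin n → Fin 2} (C : DistCircuit m π) : ℕ :=
  (C.map DistGate.cost).sum

/-- The state `|ψ⟩ ⊗ |0⋯0⟩`, with `ψ` on the input qubits and all ancilla qubits zero. -/
def withZeroAncillas {n : ℕ} (m : ℕ) (ψ : (Fin n → Bool) → ℂ) : (DistQubit n m → Bool) → ℂ :=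
  fun x => if ∀ a : Fin 2 × Fin m, x (Sum.inr a) = false then ψ (fun i => x (Sum.inl i)) else 0

/-- The circuit `C` exactly implements `U` on the input qubits with clean ancilla qubits:
`|ψ⟩|0⟩` is mapped to `(U|ψ⟩)|0⟩` for every state `ψ`. -/
def DistCircuit.Implements {n m : ℕ} {π : Fin n → Fin 2} (C : DistCircuit m π)
    (U : QubitOp (Fin n)) : Prop :=
  ∀ ψ : (Fin n → Bool) → ℂ,
    C.op.mulVec (withZeroAncillas m ψ) = withZeroAncillas m (U.mulVec ψ)

/-! ### Communication complexity -/

/-- The least number of nonlocal two-qubit gates in a circuit that implements `U`, where the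
input qubits are placed according to `π` and each processor has `m` ancilla qubits. -/
noncomputable def commComplexityGiven {n : ℕ} (m : ℕ) (π : Fin n → Fin 2)
    (U : QubitOp (Fin n)) : ℕ∞ :=
  ⨅ C : {C : DistCircuit m π // C.Implements U}, (C.1.cost : ℕ∞)

/-- Both processors hold `n / 2` input qubits, up to the additive constant `c`. -/
def IsBalanced (c : ℝ) {n : ℕ} (π : Fin n → Fin 2) : Prop :=
  ∀ p : Fin 2, |((Finset.univ.filter (fun i => π i = p)).card : ℝ) - (n : ℝ) / 2| ≤ c

/-- The communication complexity with `m` ancilla qubits per processor: the minimum over all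
balanced partitions, where `c` is the constant allowed in "balanced". -/
noncomputable def commComplexity (c : ℝ) {n : ℕ} (m : ℕ) (U : QubitOp (Fin n)) : ℕ∞ :=
  ⨅ π : {π : Fin n → Fin 2 // IsBalanced c π}, commComplexityGiven m π.1 U

/-- The communication complexity with an unlimited number of ancilla qubits. -/
noncomputable def commComplexityUnbounded (c : ℝ) {n : ℕ} (U : QubitOp (Fin n)) : ℕ∞ :=
  ⨅ m : ℕ, commComplexity c m U

/-!
Upper bound. A rotation `exp(iπP/4)` about a Pauli operator `P` turns every Pauli operator that
anticommutes with `P` into `iP` times it, and fixes the others. So, for anticommuting Pauli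
operators `P` and `Q`, one rotation turns `P` into `Q`. Given a Clifford operator `U`, for each
qubit at most two rotations after `U` make it commute with `X` on this qubit, and two more make
it commute with `Z`, while what commuted with `U` before still does. An operator that commutes
with all `X` and `Z` is a scalar, so `U` is a product of at most `4 * n` rotations, up to a phase
(`IsClifford.isRotProduct`). A Pauli operator is a product `A * B` of Pauli operators of the two
processors. Each processor writes the eigenvalue of its factor into its ancilla qubit; a rotation
about `Z ⊗ Z` on the two ancilla qubits then acts as the rotation about `A * B`
(`isImplementable_rot`). So every rotation takes one nonlocal gate, for any placement of the
inputs.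

Lower bound. The operator of a two-processor circuit with `k` nonlocal gates is a sum of `4 ^ k`
products of local operators (`DistCircuit.hasTensorLength_op`), whatever the number of ancilla
qubits. Hence, if the circuit permutes basis states, then inputs that differ at one processor only
lead to at most `4 ^ k` distinct outputs at the other one (`DistCircuit.Implements.card_le`). The
hard CNOT circuits compute `(u, v) ↦ (u + N v, v)` on two halves of the register, where `N` is a
matrix over `𝔽₂` all of whose large submatrices have linear rank; such a matrix exists by counting
(`exists_forall_lt_finrank_range`). Under a balanced partition, some processor holds about
half of the bits of `u` or more, and then the other one holds about half of the bits of `v` or more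
(`IsBalanced.exists_processors`), so a block of `N` of linear rank has to be transmitted.
-/

/-! ### Operators placed on a part of the register -/

section OnQubits

variable {ι κ μ : Type} [Fintype ι] [Fintype κ] [Fintype μ]
  [DecidableEq ι] [DecidableEq κ] [DecidableEq μ]

theorem onQubits_apply (f : κ → ι) (V : QubitOp κ) (x y : ι → Bool) :
    onQubits f V x y =
      if ∀ i : ι, (∀ k : κ, f k ≠ i) → x i = y i then V (x ∘ f) (y ∘ f) else 0 := rfl

theorem onQubits_one (f : κ → ι) : onQubits f (1 : QubitOp κ) = 1 := by
  ext x y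
  rw [onQubits_apply, Matrix.one_apply, Matrix.one_apply, ← ite_and]
  refine if_congr ⟨fun ⟨h, h'⟩ => ?_, fun h => by simp [h]⟩ rfl rfl
  funext i
  by_cases hi : ∃ k, f k = i
  · obtain ⟨k, rfl⟩ := hi
    exact congrFun h' k
  · exact h i (by simpa using hi)

theorem onQubits_mul {f : κ → ι} (hf : Function.Injective f) (V W : QubitOp κ) :
    onQubits f (V * W) = onQubits f V * onQubits f W := by
  ext x y
  rw [Matrix.mul_apply]
  simp only [onQubits_apply]
  by_cases h : ∀ i : ι, (∀ k : κ, f k ≠ i) → x i = y i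
  · rw [if_pos h, Matrix.mul_apply]
    -- the intermediate basis states that contribute agree with `x` outside the range of `f`
    refine Finset.sum_of_injOn (fun w => Function.extend f w x) ?_ (by simp) ?_ ?_
    · intro w _ w' _ hw
      funext k
      simpa [hf.extend_apply] using congrFun hw (f k)
    · intro z _ hz
      have : ¬ ∀ i : ι, (∀ k : κ, f k ≠ i) → x i = z i := by
        intro hx
        refine hz ⟨z ∘ f, by simp, ?_⟩
        funext i
        by_cases hi : ∃ k, f k = i
        · obtain ⟨k, rfl⟩ := hi
          simp [hf.extend_apply]
        · exact (Function.extend_apply' _ _ _ hi).trans (hx i (by simpa using hi))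
      rw [if_neg this, zero_mul]
    · intro w _
      have h1 : ∀ i : ι, (∀ k : κ, f k ≠ i) → Function.extend f w x i = x i := fun i hi =>
        Function.extend_apply' _ _ _ (by simpa using hi)
      have h2 : Function.extend f w x ∘ f = w := funext fun k => hf.extend_apply _ _ _
      simp only [h2]
      rw [if_pos fun i hi => (h1 i hi).symm, if_pos fun i hi => (h1 i hi).trans (h i hi)]
  · rw [if_neg h]
    refine (Finset.sum_eq_zero fun z _ => ?_).symm
    by_cases h1 : ∀ i : ι, (∀ k : κ, f k ≠ i) → x i = z i
    · rw [if_neg (c := ∀ i : ι, (∀ k : κ, f k ≠ i) → z i = y i)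
        fun h2 => h fun i hi => (h1 i hi).trans (h2 i hi), mul_zero]
    · rw [if_neg h1, zero_mul]

/-- Operators on the register `κ` act on the register `ι` through an injective placement
`f : κ → ι` of the qubits. -/
noncomputable def onQubitsHom (f : κ → ι) (hf : Function.Injective f) :
    QubitOp κ →⋆ₐ[ℂ] QubitOp ι where
  toFun := onQubits f
  map_one' := onQubits_one f
  map_mul' := onQubits_mul hf
  map_zero' := by ext x y; simp [onQubits_apply]
  map_add' V W := by
    ext x y
    simp only [onQubits_apply, Matrix.add_apply]
    split_ifs <;> simp
  commutes' r := by
    rw [Algebra.algebraMap_eq_smul_one, Algebra.algebraMap_eq_smul_one]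
    rw [← onQubits_one f]
    ext x y
    simp only [onQubits_apply, Matrix.smul_apply]
    split_ifs <;> simp
  map_star' V := by
    ext x y
    simp only [onQubits_apply, Matrix.star_apply]
    have : (∀ i : ι, (∀ k : κ, f k ≠ i) → x i = y i) ↔
        (∀ i : ι, (∀ k : κ, f k ≠ i) → y i = x i) := by
      simp only [eq_comm]
    rw [if_congr this rfl rfl]
    split_ifs <;> simp

theorem onQubitsHom_apply {f : κ → ι} (hf : Function.Injective f) (V : QubitOp κ) :
    onQubitsHom f hf V = onQubits f V := rfl

theorem onQubits_injective {f : κ → ι} (hf : Function.Injective f) :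
    Function.Injective (onQubits f) := by
  intro V W h
  ext x y
  have h1 := congrFun (congrFun h (Function.extend f x fun _ => false))
    (Function.extend f y fun _ => false)
  have h2 : ∀ w : κ → Bool, Function.extend f w (fun _ => false) ∘ f = w := fun w =>
    funext fun k => hf.extend_apply _ _ _
  have h3 : ∀ i : ι, (∀ k : κ, f k ≠ i) →
      Function.extend f x (fun _ => false) i = Function.extend f y (fun _ => false) i := by
    intro i hi
    rw [Function.extend_apply' _ _ _ (by simpa using hi),
      Function.extend_apply' _ _ _ (by simpa using hi)]
  rwa [onQubits_apply, onQubits_apply, if_pos h3, if_pos h3, h2, h2] at h1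

theorem onQubits_onQubits {f : κ → ι} (hf : Function.Injective f) (g : μ → κ) (V : QubitOp μ) :
    onQubits f (onQubits g V) = onQubits (f ∘ g) V := by
  ext x y
  simp only [onQubits_apply]
  rw [← ite_and]
  refine if_congr ⟨fun ⟨h, h'⟩ i hi => ?_, fun h => ⟨fun i hi => h i fun k => hi _,
    fun k hk => h _ fun l hl => hk l (hf hl)⟩⟩ rfl rfl
  by_cases hk : ∃ k, f k = i
  · obtain ⟨k, rfl⟩ := hk
    exact h' k fun l hl => hi l (by simp [hl])
  · exact h i (by simpa using hk)

/-- Operators placed on disjoint sets of qubits multiply as a tensor product. -/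
theorem onQubits_mul_onQubits_apply {f : κ → ι} {g : μ → ι} (hfg : ∀ k l, f k ≠ g l)
    (V : QubitOp κ) (W : QubitOp μ) (x y : ι → Bool) :
    (onQubits f V * onQubits g W) x y =
      if ∀ i : ι, (∀ k, f k ≠ i) → (∀ l, g l ≠ i) → x i = y i then
        V (x ∘ f) (y ∘ f) * W (x ∘ g) (y ∘ g) else 0 := by
  classical
  rw [Matrix.mul_apply]
  simp only [onQubits_apply]
  -- the only intermediate basis state that contributes
  set z : ι → Bool := fun i => if ∃ k, f k = i then y i else x i with hz
  rw [Finset.sum_eq_single z]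
  · have h1 : ∀ i : ι, (∀ k : κ, f k ≠ i) → x i = z i := fun i hi => by
      rw [hz]; simp only; rw [if_neg (by simpa using hi)]
    have h2 : z ∘ f = y ∘ f := funext fun k => by simp [hz]
    have h3 : z ∘ g = x ∘ g := funext fun l => (h1 _ fun k => hfg k l).symm
    rw [if_pos h1, h2, h3, mul_ite, mul_zero]
    refine if_congr ⟨fun h i hi hi' => (h1 i hi).trans (h i hi'), fun h i hi' => ?_⟩ rfl rfl
    by_cases hi : ∃ k, f k = i
    · simp [hz, hi]
    · have hi : ∀ k, f k ≠ i := by simpa using hi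
      rw [← h1 i hi, h i hi hi']
  · intro w _ hw
    by_cases h1 : ∀ i : ι, (∀ k : κ, f k ≠ i) → x i = w i
    · by_cases h2 : ∀ i : ι, (∀ l, g l ≠ i) → w i = y i
      · refine absurd ?_ hw
        funext i
        by_cases hi : ∃ k, f k = i
        · obtain ⟨k, rfl⟩ := hi
          simp [hz, h2 (f k) fun l => (hfg k l).symm]
        · simp [hz, hi, h1 i (by simpa using hi)]
      · rw [if_neg h2, mul_zero]
    · rw [if_neg h1, zero_mul]
  · simp

theorem onQubits_commute {f : κ → ι} {g : μ → ι} (hfg : ∀ k l, f k ≠ g l)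
    (V : QubitOp κ) (W : QubitOp μ) : Commute (onQubits f V) (onQubits g W) := by
  ext x y
  rw [onQubits_mul_onQubits_apply hfg, onQubits_mul_onQubits_apply fun k l => (hfg l k).symm]
  refine if_congr ⟨fun h i hi hi' => h i hi' hi, fun h i hi hi' => h i hi' hi⟩ (mul_comm _ _) rfl

/-- The operators that act on the qubits `q` with `c q = p` only. -/
noncomputable def localOps (c : ι → Fin 2) (p : Fin 2) : StarSubalgebra ℂ (QubitOp ι) :=
  (onQubitsHom (Subtype.val : {q : ι // c q = p} → ι) Subtype.val_injective).range

theorem mem_localOps {c : ι → Fin 2} {p : Fin 2} {M : QubitOp ι} :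
    M ∈ localOps c p ↔ ∃ W, onQubits (Subtype.val : {q : ι // c q = p} → ι) W = M := Iff.rfl

theorem localOps_commute_of_ne {c : ι → Fin 2} {p p' : Fin 2} (hp : p ≠ p') {M N : QubitOp ι}
    (hM : M ∈ localOps c p) (hN : N ∈ localOps c p') : Commute M N := by
  obtain ⟨V, rfl⟩ := hM
  obtain ⟨W, rfl⟩ := hN
  exact onQubits_commute (fun k l h => hp (k.2.symm.trans ((congrArg c h).trans l.2))) V W

theorem localOps_commute {c : ι → Fin 2} {M N : QubitOp ι} (hM : M ∈ localOps c 0)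
    (hN : N ∈ localOps c 1) : Commute M N :=
  localOps_commute_of_ne (by decide) hM hN

/-- An operator placed on qubits of one part only is local to this part. -/
theorem onQubits_mem_localOps {c : ι → Fin 2} {p : Fin 2} {f : κ → ι} (hf : ∀ k, c (f k) = p)
    (V : QubitOp κ) : onQubits f V ∈ localOps c p := by
  refine ⟨onQubits (fun k => (⟨f k, hf k⟩ : {q // c q = p})) V, ?_⟩
  exact onQubits_onQubits Subtype.val_injective _ V

/-- Placing the qubits into a larger register maps local operators to local operators. -/
theorem onQubits_mem_localOps_of_mem {d : κ → Fin 2} {c : ι → Fin 2} {p : Fin 2} {f : κ → ι}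
    (hf : Function.Injective f) (hc : ∀ k, c (f k) = d k) {V : QubitOp κ}
    (hV : V ∈ localOps d p) : onQubits f V ∈ localOps c p := by
  obtain ⟨W, rfl⟩ := hV
  change onQubits f (onQubits Subtype.val W) ∈ _
  rw [onQubits_onQubits hf]
  exact onQubits_mem_localOps (fun k => (hc _).trans k.2) W

end OnQubits

/-! ### The Pauli group -/

section Pauli

variable {ι κ : Type} [Fintype ι] [Fintype κ] [DecidableEq ι] [DecidableEq κ]

/-- The Pauli matrix `X`. -/
def pauliXOp : QubitOp (Fin 1) := fun x y => if x = y then 0 else 1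

/-- The Pauli matrix `Z`. -/
def pauliZOp : QubitOp (Fin 1) :=
  fun x y => if x = y then (if y 0 = true then -1 else 1) else 0

/-- The Pauli operator `X` on the qubit `q`. -/
def pauliX (q : ι) : QubitOp ι := onQubits ![q] pauliXOp

/-- The Pauli operator `Z` on the qubit `q`. -/
def pauliZ (q : ι) : QubitOp ι := onQubits ![q] pauliZOp

theorem singleQubit_injective {α : Type} (q : α) : Function.Injective ![q] :=
  Function.injective_of_subsingleton _

theorem sum_singleQubit (g : (Fin 1 → Bool) → ℂ) :
    ∑ z, g z = g (fun _ => false) + g (fun _ => true) := by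
  rw [← (Equiv.funUnique (Fin 1) Bool).symm.sum_comp]
  simp only [Fintype.sum_bool]
  rw [add_comm]
  rfl

theorem exists_eq_const (x : Fin 1 → Bool) : ∃ b, x = fun _ => b :=
  ⟨x 0, funext fun i => by rw [Subsingleton.elim i 0]⟩

theorem const_eq_const_iff {a b : Bool} : ((fun _ => a : Fin 1 → Bool) = fun _ => b) ↔ a = b :=
  ⟨fun h => congrFun h 0, fun h => by rw [h]⟩

theorem pauliX_mul_self (q : ι) : pauliX q * pauliX q = 1 := by
  rw [pauliX, ← onQubits_mul (singleQubit_injective q), ← onQubits_one ![q]]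
  congr 1
  ext x y
  obtain ⟨a, rfl⟩ := exists_eq_const x
  obtain ⟨b, rfl⟩ := exists_eq_const y
  rw [Matrix.mul_apply, sum_singleQubit, Matrix.one_apply]
  cases a <;> cases b <;> simp [pauliXOp, const_eq_const_iff]

theorem pauliZ_mul_self (q : ι) : pauliZ q * pauliZ q = 1 := by
  rw [pauliZ, ← onQubits_mul (singleQubit_injective q), ← onQubits_one ![q]]
  congr 1
  ext x y
  obtain ⟨a, rfl⟩ := exists_eq_const x
  obtain ⟨b, rfl⟩ := exists_eq_const y
  rw [Matrix.mul_apply, sum_singleQubit, Matrix.one_apply]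
  cases a <;> cases b <;> simp [pauliZOp, const_eq_const_iff]

theorem pauliX_mul_pauliZ (q : ι) : pauliX q * pauliZ q = -(pauliZ q * pauliX q) := by
  rw [pauliX, pauliZ, ← onQubits_mul (singleQubit_injective q),
    ← onQubits_mul (singleQubit_injective q), ← onQubitsHom_apply (singleQubit_injective q),
    ← onQubitsHom_apply (singleQubit_injective q), ← map_neg]
  congr 1
  ext x y
  obtain ⟨a, rfl⟩ := exists_eq_const x
  obtain ⟨b, rfl⟩ := exists_eq_const y
  rw [Matrix.neg_apply, Matrix.mul_apply, Matrix.mul_apply, sum_singleQubit, sum_singleQubit]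
  cases a <;> cases b <;> simp [pauliXOp, pauliZOp, const_eq_const_iff]

theorem star_pauliX (q : ι) : star (pauliX q) = pauliX q := by
  rw [pauliX, ← onQubitsHom_apply (singleQubit_injective q), ← map_star]
  congr 1
  ext x y
  rw [Matrix.star_apply]
  simp only [pauliXOp]
  simp only [eq_comm (a := y)]
  split_ifs <;> simp

theorem star_pauliZ (q : ι) : star (pauliZ q) = pauliZ q := by
  rw [pauliZ, ← onQubitsHom_apply (singleQubit_injective q), ← map_star]
  congr 1
  ext x y
  rw [Matrix.star_apply]
  simp only [pauliZOp]
  by_cases h : x = y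
  · subst h
    simp only [if_true]
    split_ifs <;> simp
  · simp [h, Ne.symm h]

theorem onQubits_pauliX {f : κ → ι} (hf : Function.Injective f) (k : κ) :
    onQubits f (pauliX k) = pauliX (f k) := by
  rw [pauliX, onQubits_onQubits hf, pauliX]
  congr 1
  funext i
  rw [Subsingleton.elim i 0]; rfl

theorem onQubits_pauliZ {f : κ → ι} (hf : Function.Injective f) (k : κ) :
    onQubits f (pauliZ k) = pauliZ (f k) := by
  rw [pauliZ, onQubits_onQubits hf, pauliZ]
  congr 1
  funext i
  rw [Subsingleton.elim i 0]; rfl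

theorem pauliX_commute_pauliX (q r : ι) : Commute (pauliX q) (pauliX r) := by
  by_cases h : q = r
  · rw [h]
  · exact onQubits_commute (by simpa using h) _ _

theorem pauliZ_commute_pauliZ (q r : ι) : Commute (pauliZ q) (pauliZ r) := by
  by_cases h : q = r
  · rw [h]
  · exact onQubits_commute (by simpa using h) _ _

theorem pauliX_commute_pauliZ {q r : ι} (h : q ≠ r) : Commute (pauliX q) (pauliZ r) :=
  onQubits_commute (by simpa using h) _ _

theorem pauliZ_eq_diagonal (q : ι) :
    pauliZ q = Matrix.diagonal fun x => if x q = true then -1 else 1 := by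
  ext x y
  rw [pauliZ, onQubits_apply, pauliZOp, Matrix.diagonal_apply, ← ite_and]
  by_cases h : x = y
  · subst h
    simp
  · rw [if_neg h, if_neg]
    rintro ⟨h1, h2⟩
    refine h (funext fun i => ?_)
    by_cases hi : q = i
    · simpa [hi] using congrFun h2 0
    · exact h1 i fun _ => by simpa using hi

theorem pauliX_apply (q : ι) (x y : ι → Bool) :
    pauliX q x y = if x = Function.update y q (!y q) then 1 else 0 := by
  have h1 : (¬ x ∘ ![q] = y ∘ ![q]) ↔ x q = !y q := by
    rw [Bool.eq_not]
    refine not_congr ⟨fun h => congrFun h 0, fun h => funext fun i => ?_⟩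
    rw [Subsingleton.elim i 0]; exact h
  have h2 : (∀ i : ι, (∀ k : Fin 1, ![q] k ≠ i) → x i = y i) ↔
      ∀ i, i ≠ q → x i = y i := by
    simp [eq_comm]
  have h3 : x = Function.update y q (!y q) ↔
      (∀ i : ι, (∀ k : Fin 1, ![q] k ≠ i) → x i = y i) ∧ ¬ x ∘ ![q] = y ∘ ![q] := by
    rw [Function.eq_update_iff, h1, h2, and_comm]
  rw [pauliX, onQubits_apply]
  simp only [pauliXOp]
  by_cases h : x = Function.update y q (!y q)
  · rw [if_pos h, if_pos (h3.1 h).1, if_neg (h3.1 h).2]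
  · rw [if_neg h]
    by_cases h4 : ∀ i : ι, (∀ k : Fin 1, ![q] k ≠ i) → x i = y i
    · rw [if_pos h4, if_pos (not_not.1 fun h5 => h (h3.2 ⟨h4, h5⟩))]
    · rw [if_neg h4]

/-- An operator that commutes with every single-qubit Pauli operator is a scalar. -/
theorem eq_smul_one_of_commute_pauli {M : QubitOp ι}
    (hX : ∀ q, Commute M (pauliX q)) (hZ : ∀ q, Commute M (pauliZ q)) :
    ∃ c : ℂ, M = c • 1 := by
  -- commuting with the `Z` makes `M` diagonal
  have hoff : ∀ x y, x ≠ y → M x y = 0 := by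
    intro x y hxy
    obtain ⟨q, hq⟩ := Function.ne_iff.1 hxy
    have h := congrFun (congrFun (hZ q).eq x) y
    rw [pauliZ_eq_diagonal, Matrix.mul_diagonal, Matrix.diagonal_mul] at h
    rcases Bool.eq_false_or_eq_true (x q) with hx | hx
    · have hy : y q = false := by simpa [hx] using hq.symm
      simp only [hx, hy, if_true, Bool.false_eq_true, if_false] at h
      linear_combination (1 / 2) * h
    · have hy : y q = true := by simpa [hx] using hq.symm
      simp only [hx, hy, if_true, Bool.false_eq_true, if_false] at h
      linear_combination (-1 / 2) * h
  -- commuting with the `X` makes the diagonal invariant under bit flips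
  have hflip : ∀ x q, M (Function.update x q (!x q)) (Function.update x q (!x q)) = M x x := by
    intro x q
    have h := congrFun (congrFun (hX q).eq (Function.update x q (!x q))) x
    rw [Matrix.mul_apply, Matrix.mul_apply] at h
    simp only [pauliX_apply] at h
    rw [Finset.sum_eq_single (Function.update x q (!x q)),
      Finset.sum_eq_single x] at h
    · simpa using h
    · intro z _ hz
      rw [hoff z x hz, mul_zero]
    · simp
    · intro z _ hz
      rw [hoff _ z hz.symm, zero_mul]
    · simp
  have hupd : ∀ x q b, M (Function.update x q b) (Function.update x q b) = M x x := by
    intro x q b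
    by_cases hb : b = x q
    · rw [hb, Function.update_eq_self]
    · rw [Bool.eq_not_of_ne hb, hflip]
  have hconst : ∀ x, M x x = M (fun _ => false) (fun _ => false) := by
    intro x
    have : ∀ s : Finset ι, M (s.piecewise x fun _ => false) (s.piecewise x fun _ => false) =
        M (fun _ => false) (fun _ => false) := by
      intro s
      induction s using Finset.induction_on with
      | empty => simp
      | insert a s _ ih => rw [Finset.piecewise_insert, hupd, ih]
    simpa using this Finset.univ
  refine ⟨M (fun _ => false) (fun _ => false), ?_⟩
  ext x y
  rw [Matrix.smul_apply, Matrix.one_apply]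
  split_ifs with h
  · rw [← h, hconst]; simp
  · rw [hoff x y h]; simp

variable (ι) in
/-- The Pauli group of the register `ι`, with all phases `±1, ±i`. -/
def pauliGroup : Submonoid (QubitOp ι) :=
  Submonoid.closure ({Complex.I • 1} ∪ (Set.range pauliX ∪ Set.range pauliZ))

theorem I_mem_pauliGroup : (Complex.I • 1 : QubitOp ι) ∈ pauliGroup ι :=
  Submonoid.subset_closure (by simp)

theorem pauliX_mem_pauliGroup (q : ι) : pauliX q ∈ pauliGroup ι :=
  Submonoid.subset_closure (by simp)

theorem pauliZ_mem_pauliGroup (q : ι) : pauliZ q ∈ pauliGroup ι :=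
  Submonoid.subset_closure (by simp)

theorem I_smul_mem_pauliGroup {g : QubitOp ι} (hg : g ∈ pauliGroup ι) :
    Complex.I • g ∈ pauliGroup ι := by
  simpa using mul_mem I_mem_pauliGroup hg

theorem neg_mem_pauliGroup {g : QubitOp ι} (hg : g ∈ pauliGroup ι) : -g ∈ pauliGroup ι := by
  simpa [smul_smul] using I_smul_mem_pauliGroup (I_smul_mem_pauliGroup hg)

theorem commute_or_anticommute_mul {R : Type*} [Ring R] {a b c : R}
    (ha : a * c = c * a ∨ a * c = -(c * a)) (hb : b * c = c * b ∨ b * c = -(c * b)) :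
    a * b * c = c * (a * b) ∨ a * b * c = -(c * (a * b)) := by
  rcases ha with ha | ha <;> rcases hb with hb | hb
  · left; rw [mul_assoc, hb, ← mul_assoc, ha, mul_assoc]
  · right; rw [mul_assoc, hb, mul_neg, ← mul_assoc, ha, mul_assoc]
  · right; rw [mul_assoc, hb, ← mul_assoc, ha, neg_mul, mul_assoc]
  · left; rw [mul_assoc, hb, mul_neg, ← mul_assoc, ha, neg_mul, neg_neg, mul_assoc]

theorem commute_or_anticommute_symm {R : Type*} [Ring R] {a b : R}
    (h : a * b = b * a ∨ a * b = -(b * a)) : b * a = a * b ∨ b * a = -(a * b) :=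
  h.imp Eq.symm fun h => by rw [h, neg_neg]

theorem commute_or_anticommute {g h : QubitOp ι} (hg : g ∈ pauliGroup ι)
    (hh : h ∈ pauliGroup ι) : g * h = h * g ∨ g * h = -(h * g) := by
  induction hg, hh using Submonoid.closure_induction₂ with
  | mem x y hx hy =>
    rcases hx with rfl | ⟨q, rfl⟩ | ⟨q, rfl⟩
    · left; simp
    · rcases hy with rfl | ⟨r, rfl⟩ | ⟨r, rfl⟩
      · left; simp
      · exact Or.inl (pauliX_commute_pauliX q r)
      · by_cases h : q = r
        · subst h
          exact Or.inr (pauliX_mul_pauliZ q)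
        · exact Or.inl (pauliX_commute_pauliZ h)
    · rcases hy with rfl | ⟨r, rfl⟩ | ⟨r, rfl⟩
      · left; simp
      · by_cases h : q = r
        · subst h
          right
          rw [pauliX_mul_pauliZ, neg_neg]
        · exact Or.inl (pauliX_commute_pauliZ (Ne.symm h)).symm
      · exact Or.inl (pauliZ_commute_pauliZ q r)
  | one_left => simp
  | one_right => simp
  | mul_left x y z _ _ _ h1 h2 => exact commute_or_anticommute_mul h1 h2
  | mul_right x y z _ _ _ h1 h2 =>
    exact commute_or_anticommute_symm (commute_or_anticommute_mul
      (commute_or_anticommute_symm h1) (commute_or_anticommute_symm h2))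

theorem star_mul_self_of_mem_pauliGroup {g : QubitOp ι} (hg : g ∈ pauliGroup ι) :
    star g * g = 1 := by
  induction hg using Submonoid.closure_induction with
  | mem x hx =>
    rcases hx with rfl | ⟨q, rfl⟩ | ⟨q, rfl⟩
    · simp [star_smul, smul_smul]
    · rw [star_pauliX, pauliX_mul_self]
    · rw [star_pauliZ, pauliZ_mul_self]
  | one => simp
  | mul x y _ _ hx hy =>
    rw [star_mul, mul_assoc, ← mul_assoc (star x), hx, one_mul, hy]

theorem star_eq_or_neg_of_mem_pauliGroup {g : QubitOp ι} (hg : g ∈ pauliGroup ι) :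
    star g = g ∨ star g = -g := by
  induction hg using Submonoid.closure_induction with
  | mem x hx =>
    rcases hx with rfl | ⟨q, rfl⟩ | ⟨q, rfl⟩
    · right; simp [star_smul]
    · exact Or.inl (star_pauliX q)
    · exact Or.inl (star_pauliZ q)
  | one => simp
  | mul x y hx hy h1 h2 =>
    rw [star_mul]
    rcases commute_or_anticommute hx hy with h | h <;> rcases h1 with h1 | h1 <;>
      rcases h2 with h2 | h2 <;> rw [h1, h2, h] <;> simp

/-- A Hermitian element of the Pauli group: a tensor product of Pauli matrices, with a sign. -/
def IsPauli (P : QubitOp ι) : Prop := P ∈ pauliGroup ι ∧ star P = P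

theorem isPauli_pauliX (q : ι) : IsPauli (pauliX q) := ⟨pauliX_mem_pauliGroup q, star_pauliX q⟩

theorem isPauli_pauliZ (q : ι) : IsPauli (pauliZ q) := ⟨pauliZ_mem_pauliGroup q, star_pauliZ q⟩

namespace IsPauli

variable {P Q : QubitOp ι}

theorem mul_self (hP : IsPauli P) : P * P = 1 := by
  simpa [hP.2] using star_mul_self_of_mem_pauliGroup hP.1

theorem neg (hP : IsPauli P) : IsPauli (-P) :=
  ⟨neg_mem_pauliGroup hP.1, by rw [star_neg, hP.2]⟩

theorem mul_of_commute (hP : IsPauli P) (hQ : IsPauli Q) (h : P * Q = Q * P) :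
    IsPauli (P * Q) :=
  ⟨mul_mem hP.1 hQ.1, by rw [star_mul, hP.2, hQ.2, h]⟩

theorem I_smul_mul_of_anticommute (hP : IsPauli P) (hQ : IsPauli Q) (h : P * Q = -(Q * P)) :
    IsPauli (Complex.I • (P * Q)) :=
  ⟨I_smul_mem_pauliGroup (mul_mem hP.1 hQ.1), by
    rw [star_smul, star_mul, hP.2, hQ.2, h]; simp⟩

end IsPauli

/-- A Pauli operator is a product of Pauli operators of the two parts of the register. -/
theorem IsPauli.exists_local_mul {P : QubitOp ι} (hP : IsPauli P) (c : ι → Fin 2) :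
    ∃ A B, IsPauli A ∧ IsPauli B ∧ A ∈ localOps c 0 ∧ B ∈ localOps c 1 ∧ P = A * B := by
  have key : ∀ g ∈ pauliGroup ι, ∃ A B, A ∈ pauliGroup ι ∧ B ∈ pauliGroup ι ∧
      A ∈ localOps c 0 ∧ B ∈ localOps c 1 ∧ g = A * B := by
    intro g hg
    have single : ∀ (q : ι) (V : QubitOp (Fin 1)), onQubits ![q] V ∈ pauliGroup ι →
        ∃ A B, A ∈ pauliGroup ι ∧ B ∈ pauliGroup ι ∧
        A ∈ localOps c 0 ∧ B ∈ localOps c 1 ∧ onQubits ![q] V = A * B := by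
      intro q V hV
      have hq : c q = 0 ∨ c q = 1 := by omega
      rcases hq with hq | hq
      · exact ⟨_, 1, hV, one_mem _, onQubits_mem_localOps (by simpa using hq) V, one_mem _,
          (mul_one _).symm⟩
      · exact ⟨1, _, one_mem _, hV, one_mem _, onQubits_mem_localOps (by simpa using hq) V,
          (one_mul _).symm⟩
    induction hg using Submonoid.closure_induction with
    | mem x hx =>
      rcases hx with rfl | ⟨q, rfl⟩ | ⟨q, rfl⟩
      · exact ⟨Complex.I • 1, 1, I_mem_pauliGroup, one_mem _,
          SMulMemClass.smul_mem _ (one_mem _), one_mem _, (mul_one _).symm⟩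
      · exact single q _ (pauliX_mem_pauliGroup q)
      · exact single q _ (pauliZ_mem_pauliGroup q)
    | one => exact ⟨1, 1, one_mem _, one_mem _, one_mem _, one_mem _, (mul_one _).symm⟩
    | mul x y _ _ hx hy =>
      obtain ⟨A, B, h1, h2, h3, h4, rfl⟩ := hx
      obtain ⟨A', B', h1', h2', h3', h4', rfl⟩ := hy
      refine ⟨A * A', B * B', mul_mem h1 h1', mul_mem h2 h2', mul_mem h3 h3', mul_mem h4 h4', ?_⟩
      have := (localOps_commute h3' h4).eq
      rw [mul_assoc, ← mul_assoc B, ← this]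
      simp only [mul_assoc]
  obtain ⟨A, B, hA, hB, hA', hB', rfl⟩ := key P hP.1
  have hcomm := (localOps_commute hA' hB').eq
  -- the second factor inherits Hermiticity from the product
  have herm : ∀ A B : QubitOp ι, A ∈ pauliGroup ι → A * B = B * A → star (A * B) = A * B →
      star A = A → star B = B := by
    intro A B hA hc h hs
    have h1 : A * A = 1 := by simpa [hs] using star_mul_self_of_mem_pauliGroup hA
    rw [hc, star_mul, hs, ← hc] at h
    have := congrArg (A * ·) h
    simpa [← mul_assoc, h1] using this
  rcases star_eq_or_neg_of_mem_pauliGroup hA with h | h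
  · exact ⟨A, B, ⟨hA, h⟩, ⟨hB, herm A B hA hcomm hP.2 h⟩, hA', hB', rfl⟩
  · have hs : star (Complex.I • A) = Complex.I • A := by rw [star_smul, h]; simp
    have hprod : Complex.I • A * -(Complex.I • B) = A * B := by
      simp [smul_smul]
    refine ⟨Complex.I • A, -(Complex.I • B), ⟨I_smul_mem_pauliGroup hA, hs⟩,
      ⟨neg_mem_pauliGroup (I_smul_mem_pauliGroup hB), herm (Complex.I • A) _
        (I_smul_mem_pauliGroup hA) ?_ ?_ hs⟩,
      SMulMemClass.smul_mem _ hA', neg_mem (SMulMemClass.smul_mem _ hB'), hprod.symm⟩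
    · simp [smul_smul, hcomm]
    · rw [hprod, hP.2]

end Pauli

/-! ### Pauli rotations and Clifford operators -/

section Rotation

variable {ι κ : Type} [Fintype ι] [Fintype κ] [DecidableEq ι] [DecidableEq κ]

/-- The complex number `1 / √2`. -/
noncomputable def invSqrtTwo : ℂ := ((1 / Real.sqrt 2 : ℝ) : ℂ)

theorem invSqrtTwo_mul_self : invSqrtTwo * invSqrtTwo = 1 / 2 := by
  rw [invSqrtTwo, ← Complex.ofReal_mul, div_mul_div_comm, Real.mul_self_sqrt (by norm_num)]
  norm_num

/-- The rotation `exp(iπP/4) = (1 + iP)/√2` about a Hermitian involution `P`. -/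
noncomputable def rot (P : QubitOp ι) : QubitOp ι :=
  invSqrtTwo • (1 + Complex.I • P)

theorem rot_mul_rot_neg {P : QubitOp ι} (hP : P * P = 1) : rot P * rot (-P) = 1 := by
  simp only [rot, smul_mul_assoc, mul_smul_comm, smul_smul, mul_add,
    add_mul, mul_one, one_mul, smul_neg, mul_neg, hP, smul_add]
  have hI := Complex.I_mul_I
  have hs := invSqrtTwo_mul_self
  match_scalars <;> grind

theorem star_rot {P : QubitOp ι} (hP : star P = P) : star (rot P) = rot (-P) := by
  have : star invSqrtTwo = invSqrtTwo := Complex.conj_ofReal _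
  simp only [rot, star_smul, star_add, star_one, hP, this]
  simp

theorem Commute.rot_left {P g : QubitOp ι} (h : Commute P g) : Commute (rot P) g :=
  ((Commute.one_left g).add_left (h.smul_left _)).smul_left _

/-- The rotation about `-iQP` turns `P` into `Q`, if the two anticommute. -/
theorem rot_mul_eq_mul_rot {P Q : QubitOp ι} (hP : P * P = 1) (hQ : Q * Q = 1) :
    rot (-(Complex.I • (Q * P))) * P = Q * rot (-(Complex.I • (Q * P))) := by
  simp only [rot, smul_neg, smul_smul, Complex.I_mul_I, neg_smul, neg_neg, one_smul,
    smul_mul_assoc, mul_smul_comm, add_mul, mul_add, one_mul, mul_one]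
  rw [mul_assoc, hP, ← mul_assoc, hQ, mul_one, one_mul, add_comm]

theorem rot_mul_of_anticommute {P g : QubitOp ι} (hP : P * P = 1) (h : P * g = -(g * P)) :
    rot P * g = Complex.I • (P * g) * rot P := by
  have h1 : P * g * P = -g := by rw [h, neg_mul, mul_assoc, hP, mul_one]
  simp only [rot, smul_mul_assoc, mul_smul_comm, add_mul, mul_add, one_mul, mul_one, h1,
    smul_smul, smul_add, smul_neg]
  have hI := Complex.I_mul_I
  match_scalars <;> grind

/-- A unitary operator that maps the Pauli group to itself by conjugation. -/
structure IsClifford (U : QubitOp ι) : Prop where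
  star_mul_self : star U * U = 1
  conj_mem : ∀ g ∈ pauliGroup ι, U * g * star U ∈ pauliGroup ι

namespace IsClifford

variable {U V : QubitOp ι}

theorem mul_star_self (hU : IsClifford U) : U * star U = 1 :=
  mul_eq_one_comm.1 hU.star_mul_self

theorem one : IsClifford (1 : QubitOp ι) := ⟨by simp, fun g hg => by simpa⟩

theorem mul (hU : IsClifford U) (hV : IsClifford V) : IsClifford (U * V) where
  star_mul_self := by
    rw [star_mul, mul_assoc, ← mul_assoc (star U), hU.star_mul_self, one_mul, hV.star_mul_self]
  conj_mem g hg := by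
    have := hU.conj_mem _ (hV.conj_mem g hg)
    rwa [star_mul, mul_assoc U V g, mul_assoc U (V * g), ← mul_assoc (V * g), ← mul_assoc U]

theorem star_mul_self_of_norm_eq_one {c : ℂ} (hc : ‖c‖ = 1) : star c * c = 1 := by
  simpa [hc] using Complex.conj_mul' c

theorem smul (hU : IsClifford U) {c : ℂ} (hc : ‖c‖ = 1) : IsClifford (c • U) where
  star_mul_self := by
    rw [star_smul, smul_mul_assoc, mul_smul_comm, smul_smul, star_mul_self_of_norm_eq_one hc,
      one_smul, hU.star_mul_self]
  conj_mem g hg := by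
    rw [star_smul, smul_mul_assoc, smul_mul_assoc, mul_smul_comm, smul_smul, mul_comm,
      star_mul_self_of_norm_eq_one hc, one_smul]
    exact hU.conj_mem g hg

theorem commute_star (hU : IsClifford U) {g : QubitOp ι} (h : Commute g U) :
    Commute g (star U) := by
  have h1 : star U * (g * U) * star U = star U * (U * g) * star U := by rw [h.eq]
  rw [← mul_assoc (star U) U, hU.star_mul_self, one_mul, mul_assoc, mul_assoc,
    hU.mul_star_self, mul_one] at h1
  exact h1.symm

theorem isPauli_conj (hU : IsClifford U) {P : QubitOp ι} (hP : IsPauli P) :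
    IsPauli (U * P * star U) :=
  ⟨hU.conj_mem P hP.1, by rw [star_mul, star_mul, star_star, hP.2, mul_assoc]⟩

end IsClifford

theorem isClifford_rot {P : QubitOp ι} (hP : IsPauli P) : IsClifford (rot P) where
  star_mul_self := by
    rw [star_rot hP.2]
    simpa using rot_mul_rot_neg hP.neg.mul_self
  conj_mem g hg := by
    have h1 := rot_mul_rot_neg hP.mul_self
    rw [star_rot hP.2]
    rcases commute_or_anticommute hP.1 hg with h | h
    · rwa [(Commute.rot_left h).eq, mul_assoc, h1, mul_one]
    · rw [rot_mul_of_anticommute hP.mul_self h, mul_assoc, h1, mul_one]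
      exact I_smul_mem_pauliGroup (mul_mem hP.1 hg)

/-- The Hadamard operator, up to a phase, as a product of rotations. -/
theorem rot_mul_rot_mul_rot {P Q : QubitOp ι} (hQ : Q * Q = 1)
    (h : P * Q = -(Q * P)) :
    rot Q * rot P * rot Q =
      Complex.I • invSqrtTwo • (P + Q) := by
  have h1 : Q * P * Q = -P := by
    rw [mul_assoc, h, mul_neg, ← mul_assoc, hQ, one_mul]
  simp only [rot, smul_mul_assoc, mul_smul_comm, smul_smul, mul_add,
    add_mul, mul_one, one_mul, smul_neg, hQ, h, h1, smul_add, mul_assoc]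
  have hI := Complex.I_mul_I
  have hs := invSqrtTwo_mul_self
  match_scalars <;> grind

/-- The CNOT operator, up to a phase, as a product of rotations: `P` is `Z` on the control and
`Q` is `X` on the target. -/
theorem rot_neg_mul_rot_neg_mul_rot {P Q : QubitOp ι} (hP : P * P = 1) (hQ : Q * Q = 1)
    (h : P * Q = Q * P) :
    rot (-P) * rot (-Q) * rot (P * Q) =
      (invSqrtTwo * (1 - Complex.I)) • (1 / 2 : ℂ) • (1 + P + Q - P * Q) := by
  have h1 : P * (P * Q) = Q := by rw [← mul_assoc, hP, one_mul]
  have h2 : Q * (P * Q) = P := by rw [h, ← mul_assoc, hQ, one_mul]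
  simp only [rot, smul_mul_assoc, mul_smul_comm, smul_smul, mul_add, mul_assoc, neg_mul, mul_neg,
    add_mul, mul_one, one_mul, smul_neg, h1, h2, hP, smul_add, smul_sub]
  have hI := Complex.I_mul_I
  have hs := invSqrtTwo_mul_self
  match_scalars <;> grind

theorem norm_invSqrtTwo_mul_one_sub_I :
    ‖invSqrtTwo * (1 - Complex.I)‖ = 1 := by
  have h : ‖(1 - Complex.I : ℂ)‖ = Real.sqrt 2 := by
    rw [Complex.norm_def, Complex.normSq_apply]
    norm_num
  rw [norm_mul, h, invSqrtTwo, Complex.norm_real, Real.norm_of_nonneg (by positivity)]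
  field_simp

end Rotation

/-! ### Clifford circuits -/

section CliffordCircuit

theorem onQubits_hadamardOp {n : ℕ} (i : Fin n) :
    onQubits ![i] hadamardOp = invSqrtTwo • (pauliX i + pauliZ i) := by
  have h : hadamardOp = invSqrtTwo • (pauliXOp + pauliZOp) := by
    ext x y
    obtain ⟨a, rfl⟩ := exists_eq_const x
    obtain ⟨b, rfl⟩ := exists_eq_const y
    rw [Matrix.smul_apply, Matrix.add_apply]
    simp only [hadamardOp, pauliXOp, pauliZOp, const_eq_const_iff, invSqrtTwo]
    cases a <;> cases b <;> simp
  rw [h, ← onQubitsHom_apply (singleQubit_injective i), map_smul, map_add]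
  rfl

theorem onQubits_phaseOp {n : ℕ} (i : Fin n) :
    onQubits ![i] phaseOp = (invSqrtTwo * (1 + Complex.I)) • rot (-pauliZ i) := by
  have h : phaseOp = (1 / 2 : ℂ) • ((1 + Complex.I) • 1 + (1 - Complex.I) • pauliZOp) := by
    ext x y
    obtain ⟨a, rfl⟩ := exists_eq_const x
    obtain ⟨b, rfl⟩ := exists_eq_const y
    simp only [Matrix.smul_apply, Matrix.add_apply, Matrix.one_apply]
    simp only [phaseOp, pauliZOp, const_eq_const_iff]
    cases a <;> cases b <;> simp
    · ring
    · ring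
  rw [h, ← onQubitsHom_apply (singleQubit_injective i), map_smul, map_add, map_smul, map_smul,
    map_one, onQubitsHom_apply, ← pauliZ, rot]
  have hI := Complex.I_mul_I
  have hs := invSqrtTwo_mul_self
  match_scalars <;> grind

theorem pair_injective {ι : Type} {i j : ι} (h : i ≠ j) : Function.Injective ![i, j] := by
  intro a b hab
  fin_cases a <;> fin_cases b <;> simp_all [eq_comm]

theorem onQubits_cnotOp {n : ℕ} {i j : Fin n} (h : i ≠ j) :
    onQubits ![i, j] cnotOp =
      (1 / 2 : ℂ) • (1 + pauliZ i + pauliX j - pauliZ i * pauliX j) := by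
  have h1 : cnotOp = (1 / 2 : ℂ) • (1 + pauliZ 0 + pauliX 1 - pauliZ 0 * pauliX 1) := by
    ext x y
    simp only [Matrix.smul_apply, Matrix.add_apply, Matrix.sub_apply, Matrix.one_apply,
      pauliZ_eq_diagonal, Matrix.diagonal_mul, pauliX_apply, Matrix.diagonal_apply, cnotOp,
      funext_iff, Fin.forall_fin_two, Function.update_apply]
    generalize x 0 = a
    generalize x 1 = b
    generalize y 0 = c
    generalize y 1 = d
    cases a <;> cases b <;> cases c <;> cases d <;> norm_num
  have hinj := pair_injective h
  rw [h1, ← onQubitsHom_apply hinj, map_smul, map_sub, map_add, map_add, map_mul, map_one,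
    onQubitsHom_apply, onQubitsHom_apply, onQubits_pauliX hinj, onQubits_pauliZ hinj]
  rfl

theorem CliffordGate.isClifford_op {n : ℕ} (g : CliffordGate n) : IsClifford g.op := by
  cases g with
  | hadamard i =>
    have hX := isPauli_pauliX i
    have hZ := isPauli_pauliZ i
    have h := rot_mul_rot_mul_rot hZ.mul_self (pauliX_mul_pauliZ i)
    rw [← onQubits_hadamardOp] at h
    have h2 : onQubits ![i] hadamardOp =
        (-Complex.I) • (rot (pauliZ i) * rot (pauliX i) * rot (pauliZ i)) := by
      rw [h, smul_smul]; simp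
    rw [CliffordGate.op, h2]
    exact (((isClifford_rot hZ).mul (isClifford_rot hX)).mul (isClifford_rot hZ)).smul (by simp)
  | phase i =>
    rw [CliffordGate.op, onQubits_phaseOp]
    refine (isClifford_rot (isPauli_pauliZ i).neg).smul ?_
    rw [← norm_invSqrtTwo_mul_one_sub_I, ← Complex.norm_conj, map_mul]
    simp [invSqrtTwo, sub_eq_add_neg]
  | cnot i j h =>
    have hX := isPauli_pauliX j
    have hZ := isPauli_pauliZ i
    have hc : pauliZ i * pauliX j = pauliX j * pauliZ i :=
      (pauliX_commute_pauliZ (Ne.symm h)).symm.eq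
    have h1 := rot_neg_mul_rot_neg_mul_rot hZ.mul_self hX.mul_self hc
    rw [← onQubits_cnotOp h] at h1
    have hne : invSqrtTwo * (1 - Complex.I) ≠ 0 := fun h0 => by
      simpa [h0] using norm_invSqrtTwo_mul_one_sub_I
    have h2 := congrArg ((invSqrtTwo * (1 - Complex.I))⁻¹ • ·) h1
    simp only [smul_smul, inv_mul_cancel₀ hne, one_smul] at h2
    rw [CliffordGate.op, ← h2]
    refine (((isClifford_rot hZ.neg).mul (isClifford_rot hX.neg)).mul
      (isClifford_rot (hZ.mul_of_commute hX hc))).smul ?_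
    rw [norm_inv, norm_invSqrtTwo_mul_one_sub_I, inv_one]

theorem CliffordCircuit.isClifford_op {n : ℕ} (T : CliffordCircuit n) : IsClifford T.op := by
  induction T with
  | nil => exact IsClifford.one
  | cons g T ih => exact ih.mul g.isClifford_op

end CliffordCircuit

/-! ### Clifford operators as products of rotations -/

section Decomposition

variable {ι : Type} [Fintype ι] [DecidableEq ι]

/-- Up to a phase, `U` is a product of at most `k` rotations about Pauli operators. -/
def IsRotProduct (k : ℕ) (U : QubitOp ι) : Prop :=
  ∃ (c : ℂ) (l : List (QubitOp ι)), ‖c‖ = 1 ∧ (∀ P ∈ l, IsPauli P) ∧ l.length ≤ k ∧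
    U = c • (l.map rot).prod

theorem IsRotProduct.mono {k k' : ℕ} {U : QubitOp ι} (h : IsRotProduct k U) (hk : k ≤ k') :
    IsRotProduct k' U := by
  obtain ⟨c, l, h1, h2, h3, h4⟩ := h
  exact ⟨c, l, h1, h2, h3.trans hk, h4⟩

theorem IsRotProduct.of_rot_mul {k : ℕ} {U P : QubitOp ι} (hP : IsPauli P)
    (h : IsRotProduct k (rot P * U)) : IsRotProduct (k + 1) U := by
  obtain ⟨c, l, h1, h2, h3, h4⟩ := h
  refine ⟨c, -P :: l, h1, ?_, by simpa using h3, ?_⟩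
  · simpa [hP.neg] using h2
  · have h5 := rot_mul_rot_neg hP.neg.mul_self
    rw [neg_neg] at h5
    rw [List.map_cons, List.prod_cons, ← mul_smul_comm, ← h4, ← mul_assoc, h5, one_mul]

theorem mul_eq_mul_of_anticommute {R : Type*} [Ring R] {g a b : R} (ha : g * a = -(a * g))
    (hb : g * b = -(b * g)) : g * (a * b) = a * b * g := by
  rw [← mul_assoc, ha, neg_mul, mul_assoc, hb, mul_neg, neg_neg, mul_assoc]

/-- If `U` turns `A` into a Pauli operator that anticommutes with the Pauli operator `Q`, then
one rotation after `U` makes it turn `A` into `Q`. This rotation commutes with every `g` that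
commutes with `U` and either commutes or anticommutes with both `A` and `Q`. -/
theorem IsClifford.exists_rot_conj_eq {U A Q : QubitOp ι} (hU : IsClifford U) (hA : IsPauli A)
    (hQ : IsPauli Q) (h : Q * (U * A * star U) = -(U * A * star U * Q)) :
    ∃ W, IsPauli W ∧ rot W * U * A = Q * (rot W * U) ∧ ∀ g, Commute g U →
      (g * A = A * g ∧ g * Q = Q * g) ∨ (g * A = -(A * g) ∧ g * Q = -(Q * g)) →
      Commute g (rot W * U) := by
  set P := U * A * star U with hP
  have hPauli : IsPauli P := hU.isPauli_conj hA
  have hUA : U * A = P * U := by rw [hP, mul_assoc, hU.star_mul_self, mul_one]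
  refine ⟨-(Complex.I • (Q * P)), (hQ.I_smul_mul_of_anticommute hPauli h).neg, ?_, ?_⟩
  · rw [mul_assoc, hUA, ← mul_assoc, rot_mul_eq_mul_rot hPauli.mul_self hQ.mul_self, mul_assoc]
  · intro g hgU hg
    have hgU' : g * star U = star U * g := (hU.commute_star hgU).eq
    have hgP : ∀ ε : ℤ, g * A = ε • (A * g) → g * P = ε • (P * g) := by
      intro ε h1
      rw [hP, ← mul_assoc, ← mul_assoc, hgU.eq, mul_assoc U, h1, mul_smul_comm, smul_mul_assoc,
        mul_assoc, mul_assoc, hgU', mul_assoc, mul_assoc]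
    have hgQP : Commute g (Q * P) := by
      rcases hg with ⟨h1, h2⟩ | ⟨h1, h2⟩
      · have h3 : g * P = P * g := by simpa using hgP 1 (by simpa using h1)
        exact Commute.mul_right (show Commute g Q from h2) h3
      · exact mul_eq_mul_of_anticommute h2 (by simpa using hgP (-1) (by simpa using h1))
    exact ((hgQP.symm.smul_left _).neg_left.rot_left.symm).mul_right hgU

/-- Two rotations after `U` make it commute with the Pauli operator `A`: one if `U` turns `A`
into an operator that anticommutes with `A`, and two, through an intermediate Pauli operator
`M`, if not. What commutes with `U` and is compatible with `A` and `M` still commutes. -/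
theorem IsClifford.exists_commute {U A : QubitOp ι} (hU : IsClifford U) (hA : IsPauli A)
    {S : Set (QubitOp ι)} (hSU : ∀ g ∈ S, Commute g U)
    (hSA : ∀ g ∈ S, g * A = A * g ∨ g * A = -(A * g))
    (hM : Commute A (U * A * star U) →
      ∃ M, IsPauli M ∧ M * (U * A * star U) = -(U * A * star U * M) ∧ A * M = -(M * A) ∧
        ∀ g ∈ S, (g * A = A * g ∧ g * M = M * g) ∨ (g * A = -(A * g) ∧ g * M = -(M * g))) :
    ∃ U', IsClifford U' ∧ (∀ g ∈ S, Commute g U') ∧ Commute A U' ∧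
      ∀ k, IsRotProduct k U' → IsRotProduct (k + 2) U := by
  rcases commute_or_anticommute hA.1 (hU.isPauli_conj hA).1 with h | h
  · obtain ⟨M, hMp, h1, h2, h3⟩ := hM h
    obtain ⟨W, hW, hW1, hW2⟩ := hU.exists_rot_conj_eq hA hMp h1
    have hV : IsClifford (rot W * U) := (isClifford_rot hW).mul hU
    have h4 : rot W * U * A * star (rot W * U) = M := by
      rw [hW1, mul_assoc, hV.mul_star_self, mul_one]
    obtain ⟨W', hW', hW1', hW2'⟩ := hV.exists_rot_conj_eq hA hA (by rw [h4, h2])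
    refine ⟨_, (isClifford_rot hW').mul hV, fun g hg => hW2' g (hW2 g (hSU g hg) (h3 g hg)) ?_,
      hW1'.symm, fun k hk => (hk.of_rot_mul hW').of_rot_mul hW⟩
    exact (hSA g hg).imp (fun h => ⟨h, h⟩) fun h => ⟨h, h⟩
  · obtain ⟨W, hW, hW1, hW2⟩ := hU.exists_rot_conj_eq hA hA h
    refine ⟨_, (isClifford_rot hW).mul hU, fun g hg => hW2 g (hSU g hg) ?_,
      hW1.symm, fun k hk => (hk.of_rot_mul hW).mono (Nat.le_succ _)⟩
    exact (hSA g hg).imp (fun h => ⟨h, h⟩) fun h => ⟨h, h⟩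

/-- `U` commutes with the single-qubit Pauli operators of the qubits outside `T`. -/
def FixesPaulisOutside (T : Finset ι) (U : QubitOp ι) : Prop :=
  ∀ j, j ∉ T → Commute (pauliX j) U ∧ Commute (pauliZ j) U

theorem pauliX_ne_smul_one (i : ι) (c : ℂ) : pauliX i ≠ c • 1 := by
  intro h
  have h1 := pauliX_mul_pauliZ i
  have h2 : pauliX i * pauliZ i = pauliZ i * pauliX i := by simp [h]
  have h3 : pauliX i * pauliZ i = 0 := by
    rw [← h2] at h1
    ext x y
    have h4 := congrFun (congrFun h1 x) y
    rw [Matrix.neg_apply] at h4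
    rw [Matrix.zero_apply]
    linear_combination (1 / 2) * h4
  have h4 := congrArg (pauliX i * ·) h3
  simp only [← mul_assoc, pauliX_mul_self, one_mul, mul_zero] at h4
  have h5 := pauliZ_mul_self i
  simp [h4] at h5

/-- Two rotations make `U` commute with `X` on the qubit `i`. If `U` turns `X` into an operator `P`
that commutes with `X`, the intermediate operator is `Z`, or, if `P` commutes with this as well,
`Z` times an operator at another qubit of `T` that anticommutes with `P`, which exists because
`P` is not a scalar. -/
theorem IsClifford.exists_commute_pauliX {U : QubitOp ι} (hU : IsClifford U) {T : Finset ι}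
    {i : ι} (hT : FixesPaulisOutside (insert i T) U) :
    ∃ U', IsClifford U' ∧ FixesPaulisOutside (insert i T) U' ∧ Commute (pauliX i) U' ∧
      ∀ k, IsRotProduct k U' → IsRotProduct (k + 2) U := by
  set S : Set (QubitOp ι) := {g | ∃ j, j ∉ insert i T ∧ (g = pauliX j ∨ g = pauliZ j)} with hS
  have hSX : ∀ g ∈ S, Commute g (pauliX i) := by
    rintro g ⟨j, hj, rfl | rfl⟩
    · exact pauliX_commute_pauliX _ _
    · exact (pauliX_commute_pauliZ fun h => hj (by simp [h])).symm
  have hSZ : ∀ g ∈ S, Commute g (pauliZ i) := by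
    rintro g ⟨j, hj, rfl | rfl⟩
    · exact pauliX_commute_pauliZ fun h => hj (by simp [h])
    · exact pauliZ_commute_pauliZ _ _
  have hSU : ∀ g ∈ S, Commute g U := by
    rintro g ⟨j, hj, rfl | rfl⟩
    exacts [(hT j hj).1, (hT j hj).2]
  have hX := isPauli_pauliX i
  have hZ := isPauli_pauliZ i
  set P := U * pauliX i * star U with hP
  have hPp : IsPauli P := hU.isPauli_conj hX
  obtain ⟨U', h1, h2, h3, h4⟩ := hU.exists_commute (A := pauliX i) hX hSU
    (fun g hg => Or.inl (hSX g hg)) fun hXP => by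
      rcases commute_or_anticommute hZ.1 hPp.1 with h | h
      · -- an operator at another qubit of `T` supplements `pauliZ i`
        obtain ⟨Y, hY, hYP, hYX, hYZ, hYS⟩ : ∃ Y, IsPauli Y ∧ Y * P = -(P * Y) ∧
            Commute Y (pauliX i) ∧ Commute Y (pauliZ i) ∧ ∀ g ∈ S, Commute g Y := by
          by_contra hno
          have hSP : ∀ g ∈ S, Commute g P := by
            intro g hg
            exact ((hSU g hg).mul_right (hSX g hg)).mul_right (hU.commute_star (hSU g hg))
          have hall : ∀ j, Commute P (pauliX j) ∧ Commute P (pauliZ j) := by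
            intro j
            by_cases hji : j = i
            · rw [hji]; exact ⟨hXP.symm, h.symm⟩
            by_cases hjT : j ∈ T
            · constructor
              · rcases commute_or_anticommute (pauliX_mem_pauliGroup j) hPp.1 with h' | h'
                · exact h'.symm
                · refine absurd ⟨pauliX j, isPauli_pauliX j, h', pauliX_commute_pauliX _ _,
                    pauliX_commute_pauliZ hji, ?_⟩ hno
                  rintro g ⟨l, hl, rfl | rfl⟩
                  · exact pauliX_commute_pauliX _ _
                  · exact (pauliX_commute_pauliZ fun e => hl (by simp [← e, hjT])).symm
              · rcases commute_or_anticommute (pauliZ_mem_pauliGroup j) hPp.1 with h' | h'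
                · exact h'.symm
                · refine absurd ⟨pauliZ j, isPauli_pauliZ j, h',
                    (pauliX_commute_pauliZ (Ne.symm hji)).symm, pauliZ_commute_pauliZ _ _, ?_⟩ hno
                  rintro g ⟨l, hl, rfl | rfl⟩
                  · exact pauliX_commute_pauliZ fun e => hl (by simp [e, hjT])
                  · exact pauliZ_commute_pauliZ _ _
            · have hj : j ∉ insert i T := by simp [hji, hjT]
              exact ⟨(hSP _ ⟨j, hj, Or.inl rfl⟩).symm, (hSP _ ⟨j, hj, Or.inr rfl⟩).symm⟩
          obtain ⟨c, hc⟩ := eq_smul_one_of_commute_pauli (fun j => (hall j).1) fun j => (hall j).2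
          refine pauliX_ne_smul_one i c ?_
          have h5 : star U * P * U = pauliX i := by
            rw [hP, mul_assoc, mul_assoc, hU.star_mul_self, mul_one, ← mul_assoc,
              hU.star_mul_self, one_mul]
          rw [← h5, hc, mul_smul_comm, smul_mul_assoc, mul_one, hU.star_mul_self]
        refine ⟨pauliZ i * Y, hZ.mul_of_commute hY hYZ.symm, ?_, ?_, fun g hg =>
          Or.inl ⟨hSX g hg, (hSZ g hg).mul_right (hYS g hg)⟩⟩
        · rw [mul_assoc, hYP, mul_neg, ← mul_assoc, h, mul_assoc]
        · rw [← mul_assoc, pauliX_mul_pauliZ, neg_mul, mul_assoc, ← hYX.eq, mul_assoc]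
      · exact ⟨pauliZ i, hZ, h, pauliX_mul_pauliZ i, fun g hg => Or.inl ⟨hSX g hg, hSZ g hg⟩⟩
  exact ⟨U', h1, fun j hj => ⟨h2 _ ⟨j, hj, Or.inl rfl⟩, h2 _ ⟨j, hj, Or.inr rfl⟩⟩, h3, h4⟩

/-- If `U` commutes with `X` on the qubit `i`, two rotations make it commute with `Z` as well. Here
the image of `Z` anticommutes with `X`, so that `Y` can serve as the intermediate operator. -/
theorem IsClifford.exists_commute_pauliZ {U : QubitOp ι} (hU : IsClifford U) {T : Finset ι}
    {i : ι} (hT : FixesPaulisOutside (insert i T) U) (hUX : Commute (pauliX i) U) :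
    ∃ U', IsClifford U' ∧ FixesPaulisOutside T U' ∧
      ∀ k, IsRotProduct k U' → IsRotProduct (k + 2) U := by
  set S : Set (QubitOp ι) :=
    {g | g = pauliX i ∨ ∃ j, j ∉ insert i T ∧ (g = pauliX j ∨ g = pauliZ j)} with hS
  have hX := isPauli_pauliX i
  have hZ := isPauli_pauliZ i
  have hXZ := pauliX_mul_pauliZ i
  have hZX : pauliZ i * pauliX i = -(pauliX i * pauliZ i) := by rw [hXZ, neg_neg]
  have hSU : ∀ g ∈ S, Commute g U := by
    rintro g (rfl | ⟨j, hj, rfl | rfl⟩)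
    exacts [hUX, (hT j hj).1, (hT j hj).2]
  -- `pauliX i` anticommutes with `pauliZ i` and with `Y`; the others commute with both
  have hcase : ∀ g ∈ S, g = pauliX i ∨ (Commute g (pauliX i) ∧ Commute g (pauliZ i)) := by
    rintro g (rfl | ⟨j, hj, rfl | rfl⟩)
    · exact Or.inl rfl
    · exact Or.inr ⟨pauliX_commute_pauliX _ _, pauliX_commute_pauliZ fun h => hj (by simp [h])⟩
    · exact Or.inr ⟨(pauliX_commute_pauliZ fun h => hj (by simp [h])).symm,
        pauliZ_commute_pauliZ _ _⟩
  set P := U * pauliZ i * star U with hP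
  have hPX : pauliX i * P = -(P * pauliX i) := by
    have h0 := (hU.commute_star hUX).eq
    rw [hP, ← mul_assoc, ← mul_assoc, hUX.eq, mul_assoc U, hXZ, mul_neg, neg_mul, mul_assoc,
      mul_assoc, h0, mul_assoc, mul_assoc]
  obtain ⟨U', h1, h2, h3, h4⟩ := hU.exists_commute (A := pauliZ i) hZ hSU
    (fun g hg => (hcase g hg).symm.imp (fun h => h.2.eq) fun h => by rw [h, hXZ]) fun hZP => by
      -- the intermediate operator is `Y = iXZ`
      refine ⟨_, hX.I_smul_mul_of_anticommute hZ hXZ, ?_, ?_, fun g hg => ?_⟩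
      · rw [smul_mul_assoc, mul_smul_comm, ← smul_neg, mul_assoc, hZP.eq, ← mul_assoc, hPX,
          neg_mul, mul_assoc]
      · rw [smul_mul_assoc, mul_smul_comm, ← smul_neg, ← mul_assoc, hZX, neg_mul]
      · rcases hcase g hg with rfl | ⟨h5, h6⟩
        · refine Or.inr ⟨hXZ, ?_⟩
          rw [smul_mul_assoc, mul_smul_comm, ← smul_neg, mul_assoc, hZX, mul_neg, neg_neg]
        · exact Or.inl ⟨h6, ((h5.mul_right h6).smul_right _).eq⟩
  refine ⟨U', h1, fun j hj => ?_, h4⟩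
  by_cases hji : j = i
  · rw [hji]; exact ⟨h2 _ (Or.inl rfl), h3⟩
  · have hj' : j ∉ insert i T := by simp [hji, hj]
    exact ⟨h2 _ (Or.inr ⟨j, hj', Or.inl rfl⟩), h2 _ (Or.inr ⟨j, hj', Or.inr rfl⟩)⟩

theorem norm_eq_one_of_isClifford_smul_one {c : ℂ} (h : IsClifford (c • 1 : QubitOp ι)) :
    ‖c‖ = 1 := by
  have h1 := congrFun (congrFun h.star_mul_self fun _ => false) fun _ => false
  have h2 : star c * c = 1 := by simpa [star_smul, smul_smul, mul_comm] using h1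
  have h3 : ‖c‖ * ‖c‖ = 1 := by simpa using congrArg norm h2
  nlinarith [norm_nonneg c]

/-- A Clifford operator on `n` qubits is, up to a phase, a product of at most `4 * n` rotations
about Pauli operators. -/
theorem IsClifford.isRotProduct {U : QubitOp ι} (hU : IsClifford U) :
    IsRotProduct (4 * Fintype.card ι) U := by
  have key : ∀ T : Finset ι, ∀ U : QubitOp ι, IsClifford U → FixesPaulisOutside T U →
      IsRotProduct (4 * T.card) U := by
    intro T
    induction T using Finset.induction_on with
    | empty =>
      intro U hU hT
      obtain ⟨c, rfl⟩ := eq_smul_one_of_commute_pauli (M := U)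
        (fun q => ((hT q (by simp)).1).symm) fun q => ((hT q (by simp)).2).symm
      exact ⟨c, [], norm_eq_one_of_isClifford_smul_one hU, by simp, by simp, by simp⟩
    | insert i T hi ih =>
      intro U hU hT
      obtain ⟨V, hV, hVT, hVX, hVU⟩ := hU.exists_commute_pauliX hT
      obtain ⟨W, hW, hWT, hWV⟩ := hV.exists_commute_pauliZ hVT hVX
      rw [Finset.card_insert_of_notMem hi]
      exact hVU _ (hWV _ (ih W hW hWT))
  exact key Finset.univ U hU fun j hj => absurd (Finset.mem_univ j) hj

end Decomposition

/-! ### Two-processor circuits for rotations -/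

section Implementation

theorem DistCircuit.op_append {n m : ℕ} {π : Fin n → Fin 2} (C D : DistCircuit m π) :
    DistCircuit.op (C ++ D) = D.op * C.op := by
  induction C with
  | nil => exact (mul_one _).symm
  | cons g C ih =>
    change DistCircuit.op (C ++ D) * g.op = D.op * (DistCircuit.op C * g.op)
    rw [ih, mul_assoc]

theorem DistCircuit.cost_append {n m : ℕ} {π : Fin n → Fin 2} (C D : DistCircuit m π) :
    DistCircuit.cost (C ++ D) = C.cost + D.cost := by
  simp [DistCircuit.cost]

theorem DistCircuit.Implements.append {n m : ℕ} {π : Fin n → Fin 2} {C D : DistCircuit m π}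
    {U V : QubitOp (Fin n)} (hC : C.Implements U) (hD : D.Implements V) :
    DistCircuit.Implements (C ++ D) (V * U) := by
  intro ψ
  rw [DistCircuit.op_append, ← Matrix.mulVec_mulVec, hC, hD, Matrix.mulVec_mulVec]

theorem onQubits_inl_mulVec_withZeroAncillas {n m : ℕ} (P : QubitOp (Fin n))
    (ψ : (Fin n → Bool) → ℂ) :
    (onQubits (Sum.inl : Fin n → DistQubit n m) P).mulVec (withZeroAncillas m ψ) =
      withZeroAncillas m (P.mulVec ψ) := by
  ext x
  have hiff : ∀ y : DistQubit n m → Bool,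
      (∀ i, (∀ k : Fin n, (Sum.inl k : DistQubit n m) ≠ i) → x i = y i) ↔
        ∀ a, x (Sum.inr a) = y (Sum.inr a) := fun y =>
    ⟨fun h a => h _ (by simp), fun h i hi => by
      rcases i with k | a
      · exact absurd rfl (hi k)
      · exact h a⟩
  rw [Matrix.mulVec, dotProduct]
  by_cases hx : ∀ a : Fin 2 × Fin m, x (Sum.inr a) = false
  · rw [withZeroAncillas, if_pos hx, Matrix.mulVec, dotProduct]
    symm
    refine Finset.sum_of_injOn (fun w => Sum.elim w fun _ => false) ?_ (by simp) ?_ ?_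
    · intro w _ w' _ h
      funext k
      exact congrFun h (Sum.inl k)
    · intro z _ hz
      have h1 : ¬ ∀ a : Fin 2 × Fin m, z (Sum.inr a) = false := by
        intro h
        refine hz ⟨fun k => z (Sum.inl k), by simp, ?_⟩
        funext i
        rcases i with k | a
        · rfl
        · exact (h a).symm
      rw [withZeroAncillas, if_neg h1, mul_zero]
    · intro w _
      have h1 : withZeroAncillas m ψ (Sum.elim w fun _ => false) = ψ w := if_pos fun _ => rfl
      rw [h1, onQubits_apply, if_pos ((hiff _).2 fun a => hx a)]
      rfl
  · rw [withZeroAncillas, if_neg hx]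
    refine Finset.sum_eq_zero fun z _ => ?_
    rw [onQubits_apply]
    by_cases h1 : ∀ a, x (Sum.inr a) = z (Sum.inr a)
    · have h2 : ¬ ∀ a : Fin 2 × Fin m, z (Sum.inr a) = false := fun h =>
        hx fun a => (h1 a).trans (h a)
      rw [withZeroAncillas, if_neg h2, mul_zero]
    · rw [if_neg fun h => h1 ((hiff z).1 h), zero_mul]

theorem pauliZ_mulVec_withZeroAncillas {n m : ℕ} (a : Fin 2 × Fin m)
    (ψ : (Fin n → Bool) → ℂ) :
    (pauliZ (Sum.inr a : DistQubit n m)).mulVec (withZeroAncillas m ψ) =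
      withZeroAncillas m ψ := by
  ext x
  rw [pauliZ_eq_diagonal, Matrix.mulVec_diagonal]
  by_cases hx : ∀ a : Fin 2 × Fin m, x (Sum.inr a) = false
  · simp [hx]
  · rw [withZeroAncillas, if_neg hx, mul_zero]

/-- A local unitary operator of one processor is a gate of cost zero. -/
theorem DistGate.exists_op_eq_of_mem_localOps {n m : ℕ} {π : Fin n → Fin 2} {p : Fin 2}
    {M : QubitOp (DistQubit n m)} (hM : M ∈ localOps (processorOf m π) p)
    (hU : star M * M = 1) : ∃ g : DistGate m π, g.op = M ∧ g.cost = 0 := by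
  obtain ⟨W, rfl⟩ := hM
  change star (onQubitsHom Subtype.val Subtype.val_injective W) *
    onQubitsHom Subtype.val Subtype.val_injective W = 1 at hU
  rw [← map_star, ← map_mul] at hU
  have hW : star W * W = 1 :=
    onQubits_injective Subtype.val_injective (hU.trans (onQubits_one _).symm)
  exact ⟨.onProcessor p ⟨W, Matrix.mem_unitaryGroup_iff'.2 hW⟩, rfl, rfl⟩

/-- `U` has a two-processor circuit with one ancilla qubit per processor and at most `k`
nonlocal gates. -/
def IsImplementable {n : ℕ} (π : Fin n → Fin 2) (k : ℕ) (U : QubitOp (Fin n)) : Prop :=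
  ∃ C : DistCircuit 1 π, C.Implements U ∧ C.cost ≤ k

theorem IsImplementable.mul {n : ℕ} {π : Fin n → Fin 2} {k l : ℕ} {U V : QubitOp (Fin n)}
    (hU : IsImplementable π k U) (hV : IsImplementable π l V) :
    IsImplementable π (k + l) (U * V) := by
  obtain ⟨C, hC, hCk⟩ := hU
  obtain ⟨D, hD, hDl⟩ := hV
  refine ⟨D ++ C, hD.append hC, ?_⟩
  rw [DistCircuit.cost_append]
  omega

theorem isImplementable_smul_one {n : ℕ} (π : Fin n → Fin 2) {c : ℂ} (hc : ‖c‖ = 1) :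
    IsImplementable π 0 (c • 1 : QubitOp (Fin n)) := by
  have hmem : (c • 1 : QubitOp (DistQubit n 1)) ∈ localOps (processorOf 1 π) 0 :=
    SMulMemClass.smul_mem _ (one_mem _)
  obtain ⟨g, hg, hg0⟩ := DistGate.exists_op_eq_of_mem_localOps hmem
    (IsClifford.one.smul hc).star_mul_self
  refine ⟨[g], fun ψ => ?_, ?_⟩
  · change ((1 : QubitOp (DistQubit n 1)) * g.op).mulVec _ = _
    rw [hg, one_mul, Matrix.smul_mulVec, Matrix.one_mulVec, Matrix.smul_mulVec, Matrix.one_mulVec]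
    ext x
    simp only [withZeroAncillas, Pi.smul_apply]
    split_ifs <;> simp
  · simp [DistCircuit.cost, hg0]

section Controlled

variable {ι : Type} [Fintype ι] [DecidableEq ι]

/-- The operator that applies `X` on the `-1` eigenspace of the involution `A`, and the identity
on the `+1` eigenspace. -/
noncomputable def controlledBy (A X : QubitOp ι) : QubitOp ι :=
  (1 / 2 : ℂ) • (1 + A + X - A * X)

theorem controlledBy_mul_self {A X : QubitOp ι} (hA : A * A = 1) (hX : X * X = 1)
    (h : Commute A X) : controlledBy A X * controlledBy A X = 1 := by
  have h1 : X * (A * X) = A := by rw [← mul_assoc, ← h.eq, mul_assoc, hX, mul_one]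
  have h2 : A * (A * X) = X := by rw [← mul_assoc, hA, one_mul]
  simp only [controlledBy, smul_mul_assoc, mul_smul_comm, mul_add, add_mul, mul_sub,
    sub_mul, one_mul, mul_one, mul_assoc, hA, hX, h1, h2, ← h.eq]
  match_scalars <;> norm_num

theorem star_controlledBy {A X : QubitOp ι} (hA : star A = A) (hX : star X = X)
    (h : Commute A X) : star (controlledBy A X) = controlledBy A X := by
  have : star (1 / 2 : ℂ) = 1 / 2 := by simp
  rw [controlledBy, star_smul, this, star_sub, star_add, star_add, star_mul, hA, hX, star_one,
    h.eq]

/-- Conjugation by the controlled operator multiplies `Z` by the control `A`. -/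
theorem controlledBy_mul_mul_controlledBy {A X Z : QubitOp ι} (hA : A * A = 1)
    (hX : X * X = 1) (h : Commute A X) (hAZ : Commute A Z) (hXZ : X * Z = -(Z * X)) :
    controlledBy A X * Z * controlledBy A X = A * Z := by
  have hZX : Z * X = -(X * Z) := by rw [hXZ, neg_neg]
  have h1 : Z * controlledBy A X = (1 / 2 : ℂ) • (1 + A - X + A * X) * Z := by
    rw [controlledBy, mul_smul_comm, smul_mul_assoc]
    congr 1
    simp only [mul_add, add_mul, mul_sub, sub_mul, one_mul, mul_one, hZX, ← mul_assoc, ← hAZ.eq]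
    simp only [mul_assoc, hZX, mul_neg]
    abel
  have h2 : X * (A * X) = A := by rw [← mul_assoc, ← h.eq, mul_assoc, hX, mul_one]
  have h3 : A * (A * X) = X := by rw [← mul_assoc, hA, one_mul]
  rw [mul_assoc, h1, ← mul_assoc]
  congr 1
  simp only [controlledBy, smul_mul_assoc, mul_smul_comm, mul_add, add_mul, mul_sub,
    sub_mul, one_mul, mul_one, mul_assoc, hA, hX, h2, h3, ← h.eq]
  match_scalars <;> norm_num

end Controlled

/-- A rotation about a Pauli operator takes a single nonlocal gate: the parities of the two
local factors are computed into the two ancilla qubits, the nonlocal gate rotates about `Z ⊗ Z`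
on the ancilla qubits, and the parities are uncomputed. -/
theorem isImplementable_rot {n : ℕ} (π : Fin n → Fin 2) {P : QubitOp (Fin n)} (hP : IsPauli P) :
    IsImplementable π 1 (rot P) := by
  obtain ⟨A, B, hA, hB, hAl, hBl, rfl⟩ := hP.exists_local_mul π
  have hinl : Function.Injective (Sum.inl : Fin n → DistQubit n 1) := Sum.inl_injective
  set a : DistQubit n 1 := Sum.inr (0, 0) with ha
  set b : DistQubit n 1 := Sum.inr (1, 0) with hb
  have hab : a ≠ b := by simp [ha, hb]
  have hlift : ∀ V W : QubitOp (Fin n), onQubits (Sum.inl : Fin n → DistQubit n 1) (V * W) = _ :=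
    onQubits_mul hinl
  set A' : QubitOp (DistQubit n 1) := onQubits Sum.inl A with hA'
  set B' : QubitOp (DistQubit n 1) := onQubits Sum.inl B with hB'
  have hA2 : A' * A' = 1 := by rw [hA', ← hlift, hA.mul_self, onQubits_one]
  have hB2 : B' * B' = 1 := by rw [hB', ← hlift, hB.mul_self, onQubits_one]
  have hAs : star A' = A' := by
    rw [hA', ← onQubitsHom_apply hinl, ← map_star, hA.2]
  have hBs : star B' = B' := by
    rw [hB', ← onQubitsHom_apply hinl, ← map_star, hB.2]
  have hAl' : A' ∈ localOps (processorOf 1 π) 0 :=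
    onQubits_mem_localOps_of_mem hinl (fun _ => rfl) hAl
  have hBl' : B' ∈ localOps (processorOf 1 π) 1 :=
    onQubits_mem_localOps_of_mem hinl (fun _ => rfl) hBl
  -- operators on the inputs commute with operators on the ancilla qubits
  have hanc : ∀ (V : QubitOp (Fin n)) (r : Fin 2 × Fin 1) (W : QubitOp (Fin 1)),
      Commute (onQubits (Sum.inl : Fin n → DistQubit n 1) V)
        (onQubits ![(Sum.inr r : DistQubit n 1)] W) :=
    fun V r W => onQubits_commute (by simp) V W
  have hAX : Commute A' (pauliX a) := hanc A _ _
  have hAZ : Commute A' (pauliZ a) := hanc A _ _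
  have hBX : Commute B' (pauliX b) := hanc B _ _
  have hBZ : Commute B' (pauliZ b) := hanc B _ _
  have hal : ∀ W, onQubits ![a] W ∈ localOps (processorOf 1 π) 0 :=
    onQubits_mem_localOps (by simp [ha, processorOf])
  have hbl : ∀ W, onQubits ![b] W ∈ localOps (processorOf 1 π) 1 :=
    onQubits_mem_localOps (by simp [hb, processorOf])
  set VA := controlledBy A' (pauliX a) with hVA
  set VB := controlledBy B' (pauliX b) with hVB
  have hVA2 : VA * VA = 1 := controlledBy_mul_self hA2 (pauliX_mul_self _) hAX
  have hVB2 : VB * VB = 1 := controlledBy_mul_self hB2 (pauliX_mul_self _) hBX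
  have hVAl : VA ∈ localOps (processorOf 1 π) 0 :=
    SMulMemClass.smul_mem _ (sub_mem (add_mem (add_mem (one_mem _) hAl') (hal _))
      (mul_mem hAl' (hal _)))
  have hVBl : VB ∈ localOps (processorOf 1 π) 1 :=
    SMulMemClass.smul_mem _ (sub_mem (add_mem (add_mem (one_mem _) hBl') (hbl _))
      (mul_mem hBl' (hbl _)))
  obtain ⟨gA, hgA, hgA0⟩ := DistGate.exists_op_eq_of_mem_localOps hVAl
    (by rw [hVA, star_controlledBy hAs (star_pauliX _) hAX, ← hVA, hVA2])
  obtain ⟨gB, hgB, hgB0⟩ := DistGate.exists_op_eq_of_mem_localOps hVBl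
    (by rw [hVB, star_controlledBy hBs (star_pauliX _) hBX, ← hVB, hVB2])
  have hZZ : IsPauli (pauliZ (0 : Fin 2) * pauliZ 1) :=
    (isPauli_pauliZ _).mul_of_commute (isPauli_pauliZ _) (pauliZ_commute_pauliZ _ _)
  have hinj := pair_injective hab
  let gN : DistGate 1 π := .nonlocal a b (by simp [ha, hb, processorOf])
    ⟨rot (pauliZ 0 * pauliZ 1), Matrix.mem_unitaryGroup_iff'.2 (isClifford_rot hZZ).star_mul_self⟩
  have hgN : gN.op = rot (pauliZ a * pauliZ b) := by
    change onQubits ![a, b] (rot (pauliZ 0 * pauliZ 1)) = _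
    rw [rot, ← onQubitsHom_apply hinj, map_smul, map_add, map_one, map_smul, map_mul,
      onQubitsHom_apply, onQubitsHom_apply, onQubits_pauliZ hinj, onQubits_pauliZ hinj]
    rfl
  have hZa := controlledBy_mul_mul_controlledBy hA2 (pauliX_mul_self a) hAX hAZ
    (pauliX_mul_pauliZ a)
  have hZb := controlledBy_mul_mul_controlledBy hB2 (pauliX_mul_self b) hBX hBZ
    (pauliX_mul_pauliZ b)
  rw [← hVA] at hZa
  rw [← hVB] at hZb
  have hconj : VB * VA * (pauliZ a * pauliZ b) * VA * VB =
      A' * B' * (pauliZ a * pauliZ b) := by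
    have c1 : VA * pauliZ b = pauliZ b * VA := (localOps_commute hVAl (hbl _)).eq
    have c2 : A' * pauliZ a * VB = VB * (A' * pauliZ a) :=
      (localOps_commute (mul_mem hAl' (hal _)) hVBl).eq
    have c3 : pauliZ a * B' = B' * pauliZ a := (localOps_commute (hal _) hBl').eq
    calc VB * VA * (pauliZ a * pauliZ b) * VA * VB
        = VB * (VA * pauliZ a * (pauliZ b * VA)) * VB := by simp only [mul_assoc]
      _ = VB * (VA * pauliZ a * VA * pauliZ b) * VB := by rw [← c1]; simp only [mul_assoc]
      _ = VB * (A' * pauliZ a) * (pauliZ b * VB) := by rw [hZa]; simp only [mul_assoc]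
      _ = A' * pauliZ a * (VB * pauliZ b * VB) := by rw [← c2]; simp only [mul_assoc]
      _ = A' * (pauliZ a * B') * pauliZ b := by rw [hZb]; simp only [mul_assoc]
      _ = A' * B' * (pauliZ a * pauliZ b) := by rw [c3]; simp only [mul_assoc]
  have hone : VB * VA * VA * VB = 1 := by rw [mul_assoc VB VA VA, hVA2, mul_one, hVB2]
  refine ⟨[gB, gA, gN, gA, gB], fun ψ => ?_, ?_⟩
  · have hop : DistCircuit.op [gB, gA, gN, gA, gB] =
        invSqrtTwo • (1 + Complex.I • (A' * B' * (pauliZ a * pauliZ b))) := by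
      change 1 * gB.op * gA.op * gN.op * gA.op * gB.op = _
      rw [hgA, hgB, hgN, one_mul, rot, mul_smul_comm, smul_mul_assoc, smul_mul_assoc, mul_add,
        add_mul, add_mul, mul_one, hone, mul_smul_comm, smul_mul_assoc, smul_mul_assoc, hconj]
    have hlin : ∀ φ : (Fin n → Bool) → ℂ, invSqrtTwo • (withZeroAncillas 1 ψ +
        Complex.I • withZeroAncillas 1 φ) =
          withZeroAncillas 1 (invSqrtTwo • (ψ + Complex.I • φ)) := by
      intro φ
      ext x
      simp only [withZeroAncillas, Pi.smul_apply, Pi.add_apply]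
      split_ifs <;> simp
    have hZw : (pauliZ a * pauliZ b).mulVec (withZeroAncillas 1 ψ) = withZeroAncillas 1 ψ := by
      rw [← Matrix.mulVec_mulVec, pauliZ_mulVec_withZeroAncillas, pauliZ_mulVec_withZeroAncillas]
    rw [hop, Matrix.smul_mulVec, Matrix.add_mulVec, Matrix.one_mulVec, Matrix.smul_mulVec,
      ← Matrix.mulVec_mulVec, hZw, ← hlift, onQubits_inl_mulVec_withZeroAncillas, hlin, rot,
      Matrix.smul_mulVec, Matrix.add_mulVec, Matrix.one_mulVec, Matrix.smul_mulVec]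
  · have hgN0 : gN.cost = 1 := rfl
    simp [DistCircuit.cost, hgA0, hgB0, hgN0]

theorem IsRotProduct.isImplementable {n : ℕ} (π : Fin n → Fin 2) {k : ℕ} {U : QubitOp (Fin n)}
    (h : IsRotProduct k U) : IsImplementable π k U := by
  obtain ⟨c, l, hc, hl, hk, rfl⟩ := h
  have key : ∀ l : List (QubitOp (Fin n)), (∀ P ∈ l, IsPauli P) →
      IsImplementable π l.length (l.map rot).prod := by
    intro l
    induction l with
    | nil =>
      intro _
      simpa using isImplementable_smul_one π (c := 1) (by simp)
    | cons P l ih =>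
      intro hl
      rw [List.map_cons, List.prod_cons, List.length_cons, add_comm]
      exact (isImplementable_rot π (hl P (by simp))).mul (ih fun Q hQ => hl Q (by simp [hQ]))
  obtain ⟨C, hC, hCk⟩ := (isImplementable_smul_one π hc).mul (key l hl)
  rw [smul_mul_assoc, one_mul] at hC
  exact ⟨C, hC, by omega⟩

/-- Halving the register gives a balanced partition. -/
theorem exists_isBalanced {c : ℝ} (hc : 1 / 2 ≤ c) (n : ℕ) :
    ∃ π : Fin n → Fin 2, IsBalanced c π := by
  refine ⟨fun i => if i.val < n / 2 then 0 else 1, fun p => ?_⟩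
  have h0 : (Finset.univ.filter fun i : Fin n => i.val < n / 2).card = n / 2 := by
    rw [Fin.card_filter_val_lt]
    omega
  have h1 : (Finset.univ.filter fun i : Fin n => ¬ i.val < n / 2).card = n - n / 2 := by
    have := Finset.card_filter_add_card_filter_not (s := (Finset.univ : Finset (Fin n)))
      (fun i : Fin n => i.val < n / 2)
    rw [h0, Finset.card_univ, Fintype.card_fin] at this
    omega
  have h2 : (n : ℝ) = 2 * (n / 2 : ℕ) + (n % 2 : ℕ) := by exact_mod_cast (Nat.div_add_mod n 2).symm
  have h3 : ((n % 2 : ℕ) : ℝ) ≤ 1 := by exact_mod_cast Nat.lt_succ_iff.1 (Nat.mod_lt n two_pos)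
  have h4 : (0 : ℝ) ≤ (n % 2 : ℕ) := Nat.cast_nonneg _
  fin_cases p
  · have h5 : (Finset.univ.filter fun i : Fin n => (if i.val < n / 2 then (0 : Fin 2) else 1) = 0) =
        Finset.univ.filter fun i : Fin n => i.val < n / 2 := by
      ext i; simp
    simp only [Fin.zero_eta, h5, h0]
    rw [abs_le]
    constructor <;> linarith
  · have h5 : (Finset.univ.filter fun i : Fin n => (if i.val < n / 2 then (0 : Fin 2) else 1) = 1) =
        Finset.univ.filter fun i : Fin n => ¬ i.val < n / 2 := by
      ext i; simp
    simp only [Fin.mk_one, h5, h1]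
    rw [Nat.cast_sub (Nat.div_le_self n 2), abs_le]
    constructor <;> linarith

theorem commComplexity_op_le {c : ℝ} (hc : 1 / 2 ≤ c) {n : ℕ} (T : CliffordCircuit n) :
    commComplexity c 1 T.op ≤ 4 * (n : ℕ∞) := by
  obtain ⟨π, hπ⟩ := exists_isBalanced hc n
  obtain ⟨C, hC, hCk⟩ := T.isClifford_op.isRotProduct.isImplementable π
  rw [Fintype.card_fin] at hCk
  refine iInf_le_of_le ⟨π, hπ⟩ (iInf_le_of_le ⟨C, hC⟩ ?_)
  exact_mod_cast hCk

end Implementation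

/-! ### Operator Schmidt rank of two-processor circuits -/

section TensorLength

/-- The decidability instances are found by unification, since those of two instances of
`onQubits` need not agree with the synthesized ones. -/
theorem ite_eq_ite_of_iff {α : Type*} {P Q : Prop} {hP : Decidable P} {hQ : Decidable Q}
    (h : P ↔ Q) {a b : α} : (if P then a else b) = if Q then a else b :=
  if_congr h rfl rfl

variable {ι : Type} [Fintype ι] [DecidableEq ι]

/-- `M` is a sum of at most `k` products of an operator on the part `p` and an operator on the
part `p'` of the register. -/
def HasTensorLength (c : ι → Fin 2) (p p' : Fin 2) (k : ℕ) (M : QubitOp ι) : Prop :=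
  ∃ (J : Type) (_ : Fintype J) (a b : J → QubitOp ι), Fintype.card J ≤ k ∧
    (∀ j, a j ∈ localOps c p) ∧ (∀ j, b j ∈ localOps c p') ∧ M = ∑ j, a j * b j

theorem HasTensorLength.mul {c : ι → Fin 2} {p p' : Fin 2} (hp : p ≠ p') {k l : ℕ}
    {M N : QubitOp ι} (hM : HasTensorLength c p p' k M) (hN : HasTensorLength c p p' l N) :
    HasTensorLength c p p' (k * l) (M * N) := by
  obtain ⟨J, _, a, b, hJ, ha, hb, rfl⟩ := hM
  obtain ⟨J', _, a', b', hJ', ha', hb', rfl⟩ := hN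
  refine ⟨J × J', inferInstance, fun j => a j.1 * a' j.2, fun j => b j.1 * b' j.2, ?_,
    fun j => mul_mem (ha _) (ha' _), fun j => mul_mem (hb _) (hb' _), ?_⟩
  · rw [Fintype.card_prod]
    exact Nat.mul_le_mul hJ hJ'
  · rw [Finset.sum_mul_sum, ← Finset.sum_product', Finset.univ_product_univ]
    refine Finset.sum_congr rfl fun j _ => ?_
    have h := (localOps_commute_of_ne hp (ha' j.2) (hb j.1)).eq
    rw [mul_assoc, ← mul_assoc (b j.1), ← h]
    simp only [mul_assoc]

theorem hasTensorLength_one_of_mem_left {c : ι → Fin 2} {p p' : Fin 2} {M : QubitOp ι}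
    (hM : M ∈ localOps c p) : HasTensorLength c p p' 1 M :=
  ⟨Unit, inferInstance, fun _ => M, fun _ => 1, by simp, fun _ => hM, fun _ => one_mem _,
    by simp⟩

theorem hasTensorLength_one_of_mem_right {c : ι → Fin 2} {p p' : Fin 2} {M : QubitOp ι}
    (hM : M ∈ localOps c p') : HasTensorLength c p p' 1 M :=
  ⟨Unit, inferInstance, fun _ => 1, fun _ => M, by simp, fun _ => one_mem _, fun _ => hM,
    by simp⟩

/-- The matrix unit `|u⟩⟨v|` of a single qubit. -/
def qubitUnit (u v : Bool) : QubitOp (Fin 1) := fun x y => if x 0 = u ∧ y 0 = v then 1 else 0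

/-- The block of a two-qubit operator at the row `u` and the column `v` of the first qubit. -/
def qubitBlock (V : QubitOp (Fin 2)) (u v : Bool) : QubitOp (Fin 1) :=
  fun x y => V ![u, x 0] ![v, y 0]

/-- A two-qubit operator is a sum of four products of single-qubit operators, one for each
matrix unit of the first qubit. -/
theorem onQubits_pair_eq_sum {q r : ι} (h : q ≠ r) (V : QubitOp (Fin 2)) :
    onQubits ![q, r] V = ∑ u : Bool × Bool,
      onQubits ![q] (qubitUnit u.1 u.2) * onQubits ![r] (qubitBlock V u.1 u.2) := by
  ext x y
  rw [Matrix.sum_apply]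
  simp only [onQubits_mul_onQubits_apply (f := ![q]) (g := ![r]) (by simpa using h)]
  have hx : ∀ x : ι → Bool, x ∘ ![q, r] = ![x q, x r] := fun x => by
    funext k; fin_cases k <;> rfl
  rw [Finset.sum_eq_single (x q, y q)]
  · have hiff : (∀ i : ι, (∀ k, ![q, r] k ≠ i) → x i = y i) ↔
        ∀ i : ι, (∀ k, ![q] k ≠ i) → (∀ k, ![r] k ≠ i) → x i = y i := by
      simp [Fin.forall_fin_two]
    have h1 : qubitUnit (x q) (y q) (x ∘ ![q]) (y ∘ ![q]) = 1 := if_pos ⟨rfl, rfl⟩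
    rw [onQubits_apply, hx, hx, h1, one_mul]
    exact ite_eq_ite_of_iff hiff
  · rintro ⟨u, v⟩ _ huv
    have h1 : qubitUnit u v (x ∘ ![q]) (y ∘ ![q]) = 0 := if_neg fun ⟨h, h'⟩ => huv (by
      rw [← h, ← h']; rfl)
    simp only [h1, zero_mul, ite_self]
  · simp

theorem hasTensorLength_onQubits_pair {c : ι → Fin 2} {p p' : Fin 2} (hp : p ≠ p') {q r : ι}
    (h : c q ≠ c r) (V : QubitOp (Fin 2)) : HasTensorLength c p p' 4 (onQubits ![q, r] V) := by
  have hqr : q ≠ r := fun e => h (by rw [e])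
  have hcase : (c q = p ∧ c r = p') ∨ (c q = p' ∧ c r = p) := by omega
  rcases hcase with ⟨hq, hr⟩ | ⟨hq, hr⟩
  · refine ⟨Bool × Bool, inferInstance, _, _, by simp, fun u => ?_, fun u => ?_,
      onQubits_pair_eq_sum hqr V⟩
    · exact onQubits_mem_localOps (by simpa using hq) _
    · exact onQubits_mem_localOps (by simpa using hr) _
  · refine ⟨Bool × Bool, inferInstance, _, _, by simp, fun u => ?_, fun u => ?_,
      (onQubits_pair_eq_sum hqr V).trans (Finset.sum_congr rfl fun u _ =>
        onQubits_commute (by simpa using hqr) _ _)⟩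
    · exact onQubits_mem_localOps (by simpa using hr) _
    · exact onQubits_mem_localOps (by simpa using hq) _

/-- Every nonlocal gate multiplies the operator Schmidt rank by at most four. -/
theorem DistCircuit.hasTensorLength_op {n m : ℕ} {π : Fin n → Fin 2} {p p' : Fin 2}
    (hp : p ≠ p') (C : DistCircuit m π) :
    HasTensorLength (processorOf m π) p p' (4 ^ C.cost) C.op := by
  induction C with
  | nil => exact hasTensorLength_one_of_mem_left (one_mem _)
  | cons g C ih =>
    have hg : HasTensorLength (processorOf m π) p p' (4 ^ g.cost) g.op := by
      cases g with
      | onProcessor s V =>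
        have hV : (DistGate.onProcessor s V : DistGate m π).op ∈ localOps (processorOf m π) s :=
          ⟨V.1, rfl⟩
        have hs : s = p ∨ s = p' := by omega
        rcases hs with rfl | rfl
        · exact hasTensorLength_one_of_mem_left hV
        · exact hasTensorLength_one_of_mem_right hV
      | nonlocal q r hne V => exact hasTensorLength_onQubits_pair hp hne V.1
    have hcost : DistCircuit.cost (g :: C) = DistCircuit.cost C + g.cost := by
      simp [DistCircuit.cost, add_comm]
    rw [hcost, pow_add]
    exact HasTensorLength.mul hp ih hg

/-- If `M` has a small tensor length, it has no large identity submatrix whose row index is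
determined by the part `p` of the output and whose columns share the part `p` of the input. -/
theorem HasTensorLength.card_le {c : ι → Fin 2} {p p' : Fin 2} (hp : p ≠ p') {k : ℕ}
    {M : QubitOp ι} (hM : HasTensorLength c p p' k M) {I : Type} [Fintype I] [DecidableEq I]
    (x y : I → ι → Bool) (hx : ∀ i j q, c q = p → x i q = x j q)
    (hid : ∀ i j, M (fun q => if c q = p then y i q else y j q) (x j) = if i = j then 1 else 0) :
    Fintype.card I ≤ k := by
  obtain ⟨J, _, a, b, hJ, ha, hb, rfl⟩ := hM
  rcases isEmpty_or_nonempty I with hI | ⟨⟨i₀⟩⟩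
  · simp
  choose A hA using fun j => mem_localOps.1 (ha j)
  choose B hB using fun j => mem_localOps.1 (hb j)
  have hpart : ∀ (j : J) (y x : ι → Bool), (a j * b j) y x =
      A j (y ∘ Subtype.val) (x ∘ Subtype.val) * B j (y ∘ Subtype.val) (x ∘ Subtype.val) := by
    intro j y x
    rw [← hA, ← hB, onQubits_mul_onQubits_apply
      fun k l h => hp (k.2.symm.trans ((congrArg c h).trans l.2)), if_pos]
    intro q hq hq'
    have hcq : c q = p ∨ c q = p' := by omega
    rcases hcq with h | h
    · exact absurd rfl (hq ⟨q, h⟩)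
    · exact absurd rfl (hq' ⟨q, h⟩)
  let P : Matrix I J ℂ := fun i j => A j (y i ∘ Subtype.val) (x i₀ ∘ Subtype.val)
  let Q : Matrix J I ℂ := fun j i => B j (y i ∘ Subtype.val) (x i ∘ Subtype.val)
  have hPQ : P * Q = 1 := by
    ext i i'
    rw [Matrix.mul_apply, Matrix.one_apply, ← hid i i', Matrix.sum_apply]
    refine Finset.sum_congr rfl fun j _ => ?_
    rw [hpart]
    have h1 : (fun q => if c q = p then y i q else y i' q) ∘
        (Subtype.val : {q // c q = p} → ι) = y i ∘ Subtype.val := by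
      funext q; exact if_pos q.2
    have h2 : (fun q => if c q = p then y i q else y i' q) ∘
        (Subtype.val : {q // c q = p'} → ι) = y i' ∘ Subtype.val := by
      funext q; exact if_neg fun e => hp (e.symm.trans q.2)
    have h3 : x i' ∘ (Subtype.val : {q // c q = p} → ι) = x i₀ ∘ Subtype.val := by
      funext q; exact hx _ _ _ q.2
    rw [h1, h2, h3]
  calc Fintype.card I = (1 : Matrix I I ℂ).rank := (Matrix.rank_one).symm
    _ ≤ P.rank := by rw [← hPQ]; exact Matrix.rank_mul_le_left P Q
    _ ≤ Fintype.card J := Matrix.rank_le_card_width P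
    _ ≤ k := hJ

end TensorLength

/-! ### Permutations of the basis states -/

section PermutationOperator

/-- The operator that maps the basis state `x` to the basis state `F x`. -/
def basisMapOp {ι : Type} [Fintype ι] (F : (ι → Bool) → ι → Bool) : QubitOp ι :=
  fun y x => if y = F x then 1 else 0

theorem basisMapOp_mul {ι : Type} [Fintype ι] [DecidableEq ι] (F G : (ι → Bool) → ι → Bool) :
    basisMapOp F * basisMapOp G = basisMapOp (F ∘ G) := by
  ext y x
  rw [Matrix.mul_apply, Finset.sum_eq_single (G x)]
  · simp [basisMapOp]
  · intro z _ hz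
    simp [basisMapOp, hz]
  · simp

/-- The entries of the circuit operator at inputs with zero ancilla qubits are those of `U`. -/
theorem DistCircuit.Implements.op_apply {n m : ℕ} {π : Fin n → Fin 2} {C : DistCircuit m π}
    {U : QubitOp (Fin n)} (hC : C.Implements U) (x : Fin n → Bool) (y : DistQubit n m → Bool) :
    C.op y (Sum.elim x fun _ => false) =
      if ∀ a, y (Sum.inr a) = false then U (fun i => y (Sum.inl i)) x else 0 := by
  have h1 : withZeroAncillas m (Pi.single x 1) =
      Pi.single (Sum.elim x fun _ => false : DistQubit n m → Bool) 1 := by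
    funext z
    rw [withZeroAncillas, Pi.single_apply, Pi.single_apply, ← ite_and]
    refine if_congr ⟨fun ⟨h, h'⟩ => ?_, fun h => by simp [h]⟩ rfl rfl
    funext i
    rcases i with k | a
    · exact congrFun h' k
    · exact h a
  have h2 := congrFun (hC (Pi.single x 1)) y
  rwa [h1, Matrix.mulVec_single_one, Matrix.mulVec_single_one] at h2

/-- A circuit for a permutation of the basis states needs many nonlocal gates if there are many
inputs that differ at processor `p'` only, with different outputs at processor `p`. -/
theorem DistCircuit.Implements.card_le {n m : ℕ} {π : Fin n → Fin 2} {C : DistCircuit m π}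
    {F : (Fin n → Bool) → Fin n → Bool} (hC : C.Implements (basisMapOp F)) {p p' : Fin 2}
    (hp : p ≠ p') {I : Type} [Fintype I] (x : I → Fin n → Bool)
    (hx : ∀ i q, π q = p → x i q = false)
    (hF : ∀ i j, (∀ q, π q = p → F (x i) q = F (x j) q) → i = j) :
    Fintype.card I ≤ 4 ^ C.cost := by
  classical
  refine (C.hasTensorLength_op hp).card_le hp (fun i => Sum.elim (x i) fun _ => false)
    (fun i => Sum.elim (F (x i)) fun _ => false) ?_ ?_
  · rintro i j (q | a) hq
    · exact (hx i q hq).trans (hx j q hq).symm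
    · rfl
  · intro i j
    rw [hC.op_apply, if_pos (by simp), basisMapOp]
    refine if_congr ⟨fun h => hF i j fun q hq => ?_, fun h => ?_⟩ rfl rfl
    · have h1 := congrFun h q
      simpa [processorOf, hq] using h1
    · subst h
      simp

end PermutationOperator

/-! ### CNOT circuits for linear shears -/

section Shear

variable {n h : ℕ}

/-- The linear map `(u, v) ↦ (u + N v, v)` over `𝔽₂`, where `u` and `v` are the bits at the
positions `lo` and `hi`; all other bits are unchanged. The sum over `i` has at most one nonzero
term if `lo` is injective. -/
def shear (lo hi : Fin h → Fin n) (N : Matrix (Fin h) (Fin h) (ZMod 2)) (x : Fin n → Bool) :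
    Fin n → Bool :=
  fun q => Bool.xor (x q)
    (decide ((∑ i, if lo i = q then ∑ j, N i j * (if x (hi j) = true then 1 else 0) else 0) =
      (1 : ZMod 2)))

theorem shear_hi {lo hi : Fin h → Fin n} (hd : ∀ i j, lo i ≠ hi j)
    (N : Matrix (Fin h) (Fin h) (ZMod 2)) (x : Fin n → Bool) (j : Fin h) :
    shear lo hi N x (hi j) = x (hi j) := by
  simp [shear, hd]

theorem shear_lo {lo hi : Fin h → Fin n} (hlo : Function.Injective lo)
    (N : Matrix (Fin h) (Fin h) (ZMod 2)) (x : Fin n → Bool) (i : Fin h) :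
    shear lo hi N x (lo i) = Bool.xor (x (lo i))
      (decide (∑ j, N i j * (if x (hi j) = true then 1 else 0) = (1 : ZMod 2))) := by
  simp [shear, hlo.eq_iff]

theorem decide_add_eq_one (a b : ZMod 2) :
    decide (a + b = 1) = Bool.xor (decide (a = 1)) (decide (b = 1)) := by
  revert a b; decide

theorem shear_add {lo hi : Fin h → Fin n} (hd : ∀ i j, lo i ≠ hi j)
    (N N' : Matrix (Fin h) (Fin h) (ZMod 2)) :
    shear lo hi (N + N') = shear lo hi N ∘ shear lo hi N' := by
  funext x q
  have h1 : ∀ x q, shear lo hi N x q = Bool.xor (x q)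
    (decide ((∑ i, if lo i = q then ∑ j, N i j * (if x (hi j) = true then 1 else 0) else 0) =
      (1 : ZMod 2))) := fun _ _ => rfl
  rw [Function.comp_apply, h1]
  simp only [shear_hi hd]
  rw [shear, shear, Bool.xor_assoc, ← decide_add_eq_one, ← Finset.sum_add_distrib]
  congr 3
  refine Finset.sum_congr rfl fun i _ => ?_
  split_ifs
  · rw [← Finset.sum_add_distrib]
    refine Finset.sum_congr rfl fun j _ => ?_
    rw [Matrix.add_apply, add_mul, add_comm]
  · simp

theorem shear_single {lo hi : Fin h → Fin n} (i j : Fin h) :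
    shear lo hi (Matrix.single i j 1) =
      fun x => Function.update x (lo i) (Bool.xor (x (lo i)) (x (hi j))) := by
  funext x q
  have h1 : ∀ i', ∑ j', Matrix.single i j (1 : ZMod 2) i' j' *
      (if x (hi j') = true then 1 else 0) =
        if i = i' then if x (hi j) = true then 1 else 0 else 0 := by
    intro i'
    rw [Finset.sum_eq_single j]
    · by_cases h : i = i' <;> simp [h]
    · intro j' _ hj
      simp [Ne.symm hj]
    · simp
  rw [shear]
  simp only [h1]
  rw [Finset.sum_eq_single i]
  · by_cases hq : lo i = q
    · subst hq
      cases x (hi j) <;> simp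
    · simp [hq, Function.update_of_ne (Ne.symm hq)]
  · intro i' _ hi'
    simp [Ne.symm hi']
  · simp

theorem op_cnot {c t : Fin n} (hct : c ≠ t) :
    (CliffordGate.cnot c t hct).op =
      basisMapOp fun x => Function.update x t (Bool.xor (x t) (x c)) := by
  ext y x
  rw [CliffordGate.op, onQubits_apply, basisMapOp, cnotOp, ← ite_and]
  refine ite_eq_ite_of_iff ⟨fun h => ?_, fun hy => ?_⟩
  · obtain ⟨h1, h2, h3⟩ := h
    have h2 : y c = x c := h2
    have h3 : y t = Bool.xor (x c) (x t) := h3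
    funext i
    by_cases hi : i = t
    · subst hi
      simp [h3, Bool.xor_comm]
    · rw [Function.update_of_ne hi]
      by_cases hic : i = c
      · rw [hic, h2]
      · exact h1 i fun k => by fin_cases k <;> simp [Ne.symm hi, Ne.symm hic]
  · subst hy
    refine ⟨fun i hi => ?_, ?_, ?_⟩
    · exact Function.update_of_ne (fun e => hi 1 (by simp [e])) _ _
    · exact Function.update_of_ne hct _ _
    · simp [Bool.xor_comm]

theorem CliffordCircuit.op_append (S T : CliffordCircuit n) :
    CliffordCircuit.op (S ++ T) = T.op * S.op := by
  induction S with
  | nil => exact (mul_one _).symm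
  | cons g S ih =>
    change CliffordCircuit.op (S ++ T) * g.op = T.op * (CliffordCircuit.op S * g.op)
    rw [ih, mul_assoc]

/-- Every shear is computed by a CNOT circuit: each entry `1` of `N` contributes one gate. -/
theorem exists_isCNOT_op_eq_shear {lo hi : Fin h → Fin n} (hd : ∀ i j, lo i ≠ hi j)
    (N : Matrix (Fin h) (Fin h) (ZMod 2)) :
    ∃ T : CliffordCircuit n, T.IsCNOT ∧ T.op = basisMapOp (shear lo hi N) := by
  have hzero : ∃ T : CliffordCircuit n, T.IsCNOT ∧ T.op = basisMapOp (shear lo hi 0) := by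
    refine ⟨[], by simp [CliffordCircuit.IsCNOT], ?_⟩
    ext y x
    have h1 : shear lo hi 0 x = x := by
      funext q
      simp [shear]
    change (1 : QubitOp (Fin n)) y x = _
    rw [basisMapOp, h1, Matrix.one_apply]
  induction N using Matrix.induction_on' with
  | h_zero => exact hzero
  | h_add N N' hN hN' =>
    obtain ⟨T, hT, hTop⟩ := hN
    obtain ⟨T', hT', hTop'⟩ := hN'
    refine ⟨T' ++ T, fun g hg => ?_, ?_⟩
    · rcases List.mem_append.1 hg with hg | hg
      exacts [hT' g hg, hT g hg]
    · rw [CliffordCircuit.op_append, hTop, hTop', basisMapOp_mul, shear_add hd]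
  | h_std_basis i j c =>
    have hc : c = 0 ∨ c = 1 := by revert c; decide
    rcases hc with rfl | rfl
    · rwa [Matrix.single_zero]
    · refine ⟨[.cnot (hi j) (lo i) (hd i j).symm], ?_, ?_⟩
      · intro g hg
        rw [List.mem_singleton] at hg
        exact ⟨_, _, _, hg⟩
      · change (1 : QubitOp (Fin n)) * _ = _
        rw [one_mul, op_cnot, shear_single]

end Shear

/-! ### Matrices all of whose large submatrices have high rank -/

section Rigid

/-- Rank factorization of a linear map through `K ^ r`. -/
theorem LinearMap.exists_comp_eq_of_finrank_range_le {K V W : Type*} [Field K] [AddCommGroup V]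
    [Module K V] [AddCommGroup W] [Module K W] [Module.Finite K V] (g : V →ₗ[K] W) {r : ℕ}
    (h : Module.finrank K (LinearMap.range g) ≤ r) :
    ∃ (φ : V →ₗ[K] (Fin r → K)) (ψ : (Fin r → K) →ₗ[K] W), ψ ∘ₗ φ = g := by
  have h1 : Module.finrank K (LinearMap.range g) ≤ Module.finrank K (Fin r → K) := by simpa
  obtain ⟨f, hf⟩ := finrank_le_iff_exists_linearMap.1 h1
  obtain ⟨f', hf'⟩ := f.exists_leftInverse_of_injective (LinearMap.ker_eq_bot.2 hf)
  refine ⟨f ∘ₗ g.rangeRestrict, (LinearMap.range g).subtype ∘ₗ f', ?_⟩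
  ext v
  have := LinearMap.congr_fun hf' (g.rangeRestrict v)
  simp only [LinearMap.comp_apply, LinearMap.id_apply] at this
  simp [this]

variable {h : ℕ}

/-- The submatrix of `N` with rows `R` and columns `C`, padded with zeros. -/
def maskedMatrix (N : Matrix (Fin h) (Fin h) (ZMod 2)) (R C : Finset (Fin h)) :
    Matrix (Fin h) (Fin h) (ZMod 2) :=
  fun i j => if i ∈ R ∧ j ∈ C then N i j else 0

/-- Few matrices have a submatrix of rank at most `r` in the rows `R` and the columns `C`: such
a matrix is determined by the two factors of the submatrix and by its other entries. -/
theorem card_rank_maskedMatrix_le (r : ℕ) (R C : Finset (Fin h)) :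
    Fintype.card {N : Matrix (Fin h) (Fin h) (ZMod 2) //
      Module.finrank (ZMod 2) (LinearMap.range (maskedMatrix N R C).mulVecLin) ≤ r} ≤
      2 ^ (2 * (h * r) + (h * h - R.card * C.card)) := by
  have hfac : ∀ N : {N : Matrix (Fin h) (Fin h) (ZMod 2) //
      Module.finrank (ZMod 2) (LinearMap.range (maskedMatrix N R C).mulVecLin) ≤ r},
      ∃ BD : Matrix (Fin h) (Fin r) (ZMod 2) × Matrix (Fin r) (Fin h) (ZMod 2),
        maskedMatrix N.1 R C = BD.1 * BD.2 := by
    intro N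
    obtain ⟨φ, ψ, hφψ⟩ := LinearMap.exists_comp_eq_of_finrank_range_le _ N.2
    refine ⟨(LinearMap.toMatrix' ψ, LinearMap.toMatrix' φ), ?_⟩
    rw [← LinearMap.toMatrix'_comp, hφψ, ← Matrix.toLin'_apply', LinearMap.toMatrix'_toLin']
  choose BD hBD using hfac
  let code : {N : Matrix (Fin h) (Fin h) (ZMod 2) //
      Module.finrank (ZMod 2) (LinearMap.range (maskedMatrix N R C).mulVecLin) ≤ r} →
      ((Fin h × Fin r → ZMod 2) × (Fin r × Fin h → ZMod 2)) ×
        ({e : Fin h × Fin h // e ∉ R ×ˢ C} → ZMod 2) := fun N =>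
    ((fun e => (BD N).1 e.1 e.2, fun e => (BD N).2 e.1 e.2), fun e => N.1 e.1.1 e.1.2)
  have hcode : Function.Injective code := by
    intro N N' hNN'
    simp only [code, Prod.mk.injEq] at hNN'
    obtain ⟨⟨h1, h2⟩, h3⟩ := hNN'
    have h4 : maskedMatrix N.1 R C = maskedMatrix N'.1 R C := by
      rw [hBD N, hBD N']
      congr 1
      · ext i j; exact congrFun h1 (i, j)
      · ext i j; exact congrFun h2 (i, j)
    ext i j
    by_cases hij : (i, j) ∈ R ×ˢ C
    · have h5 := congrFun (congrFun h4 i) j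
      have h6 := Finset.mem_product.1 hij
      rwa [maskedMatrix, maskedMatrix, if_pos h6, if_pos h6] at h5
    · exact congrFun h3 ⟨(i, j), hij⟩
  refine (Fintype.card_le_of_injective code hcode).trans (le_of_eq ?_)
  rw [Fintype.card_prod, Fintype.card_prod, Fintype.card_fun, Fintype.card_fun, Fintype.card_fun,
    ZMod.card, Fintype.card_prod, Fintype.card_prod, Fintype.card_fin, Fintype.card_fin,
    Fintype.card_subtype_compl, Fintype.card_prod, Fintype.card_fin, Fintype.card_coe,
    Finset.card_product, ← pow_add, ← pow_add]
  congr 1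
  ring

/-- By counting, there is a matrix all of whose submatrices with at least `s` rows and `s`
columns have rank larger than `r`. -/
theorem exists_forall_lt_finrank_range {r s : ℕ} (hs : 2 * h + 2 * (h * r) < s * s) :
    ∃ N : Matrix (Fin h) (Fin h) (ZMod 2), ∀ R C : Finset (Fin h), s ≤ R.card → s ≤ C.card →
      r < Module.finrank (ZMod 2) (LinearMap.range (maskedMatrix N R C).mulVecLin) := by
  classical
  by_contra! hbad
  set bad : Finset (Fin h) × Finset (Fin h) → Finset (Matrix (Fin h) (Fin h) (ZMod 2)) :=
    fun RC => Finset.univ.filter fun N => s ≤ RC.1.card ∧ s ≤ RC.2.card ∧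
      Module.finrank (ZMod 2) (LinearMap.range (maskedMatrix N RC.1 RC.2).mulVecLin) ≤ r
    with hbad_def
  have hcover : (Finset.univ : Finset (Matrix (Fin h) (Fin h) (ZMod 2))) ⊆
      Finset.univ.biUnion bad := by
    intro N _
    obtain ⟨R, C, hR, hC, hN⟩ := hbad N
    exact Finset.mem_biUnion.2 ⟨(R, C), Finset.mem_univ _, by simp [hbad_def, hR, hC, hN]⟩
  have hbound : ∀ RC, (bad RC).card ≤ 2 ^ (2 * (h * r) + (h * h - s * s)) := by
    rintro ⟨R, C⟩
    by_cases hRC : s ≤ R.card ∧ s ≤ C.card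
    · have h1 : (bad (R, C)).card ≤ 2 ^ (2 * (h * r) + (h * h - R.card * C.card)) := by
        refine le_trans (le_of_eq ?_) (card_rank_maskedMatrix_le r R C)
        rw [Fintype.card_subtype]
        congr 1
        ext N
        simp [hbad_def, hRC.1, hRC.2]
      refine h1.trans (Nat.pow_le_pow_right two_pos ?_)
      have := Nat.mul_le_mul hRC.1 hRC.2
      omega
    · have : bad (R, C) = ∅ := by
        ext N
        simp only [hbad_def, Finset.mem_filter, Finset.notMem_empty, iff_false]
        exact fun h => hRC ⟨h.2.1, h.2.2.1⟩
      rw [this]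
      exact Nat.zero_le _
  have hcard : Fintype.card (Matrix (Fin h) (Fin h) (ZMod 2)) = 2 ^ (h * h) := by
    change Fintype.card (Fin h → Fin h → ZMod 2) = _
    rw [Fintype.card_fun, Fintype.card_fun, ZMod.card, Fintype.card_fin, ← pow_mul]
  have h1 : 2 ^ (h * h) ≤ 2 ^ (2 * h + (2 * (h * r) + (h * h - s * s))) := by
    calc 2 ^ (h * h) = (Finset.univ : Finset (Matrix (Fin h) (Fin h) (ZMod 2))).card := by
          rw [Finset.card_univ, hcard]
      _ ≤ ∑ RC, (bad RC).card := (Finset.card_le_card hcover).trans Finset.card_biUnion_le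
      _ ≤ ∑ _RC : Finset (Fin h) × Finset (Fin h), 2 ^ (2 * (h * r) + (h * h - s * s)) :=
          Finset.sum_le_sum fun RC _ => hbound RC
      _ = 2 ^ (2 * h + (2 * (h * r) + (h * h - s * s))) := by
          rw [Finset.sum_const, Finset.card_univ, Fintype.card_prod, Fintype.card_finset,
            Fintype.card_fin, smul_eq_mul, ← pow_add, ← pow_add]
          congr 1
          ring
  have h2 := (Nat.pow_le_pow_iff_right (by norm_num)).1 h1
  -- a submatrix with `s` rows exists only if `s ≤ h`
  obtain ⟨R, C, hR, hC, _⟩ := hbad 0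
  have h3 : s ≤ h := hR.trans (by simpa using Finset.card_le_univ R)
  have h4 := Nat.mul_le_mul h3 h3
  omega

end Rigid

/-! ### Transmission of a block of the matrix -/

section LowerBound

variable {n h : ℕ}

/-- A circuit for the shear by `N` must transmit the block of `N` that leads from the positions
`C` of one processor to the positions `R` of the other. -/
theorem DistCircuit.Implements.finrank_le {m : ℕ} {π : Fin n → Fin 2} {D : DistCircuit m π}
    {lo hi : Fin h → Fin n} (hlo : Function.Injective lo) (hhi : Function.Injective hi)
    (hd : ∀ i j, lo i ≠ hi j) {N : Matrix (Fin h) (Fin h) (ZMod 2)}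
    (hD : D.Implements (basisMapOp (shear lo hi N))) {p p' : Fin 2} (hp : p ≠ p')
    {R C : Finset (Fin h)} (hR : ∀ i ∈ R, π (lo i) = p) (hC : ∀ j ∈ C, π (hi j) = p') :
    Module.finrank (ZMod 2) (LinearMap.range (maskedMatrix N R C).mulVecLin) ≤ 2 * D.cost := by
  classical
  set g := (maskedMatrix N R C).mulVecLin with hg
  have hpre : ∀ w : LinearMap.range g, ∃ z, g z = w := fun w => w.2
  choose z hz using hpre
  let x : LinearMap.range g → Fin n → Bool := fun w q => decide (∃ j ∈ C, hi j = q ∧ z w j = 1)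
  have hxhi : ∀ w j, x w (hi j) = decide (j ∈ C ∧ z w j = 1) := by
    intro w j
    simp only [x, hhi.eq_iff]
    congr 1
    simp
  have hxlo : ∀ w i, x w (lo i) = false := by
    intro w i
    simp only [x, decide_eq_false_iff_not]
    rintro ⟨j, _, h, _⟩
    exact hd i j h.symm
  have hout : ∀ w, ∀ i ∈ R, shear lo hi N (x w) (lo i) = decide (w.1 i = 1) := by
    intro w i hi'
    rw [shear_lo hlo, hxlo, Bool.false_xor, ← hz w, hg, Matrix.mulVecLin_apply, Matrix.mulVec,
      dotProduct]
    congr 2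
    refine Finset.sum_congr rfl fun j _ => ?_
    simp only [hxhi, maskedMatrix]
    have h01 : ∀ a : ZMod 2, a = if a = 1 then 1 else 0 := by decide
    by_cases hj : j ∈ C
    · rw [h01 (z w j)]
      by_cases h1 : z w j = 1 <;> simp [hj, hi', h1]
    · simp [hj]
  have hzero : ∀ w : LinearMap.range g, ∀ i, i ∉ R → w.1 i = 0 := by
    intro w i hi'
    rw [← hz w, hg, Matrix.mulVecLin_apply, Matrix.mulVec, dotProduct]
    refine Finset.sum_eq_zero fun j _ => ?_
    rw [maskedMatrix, if_neg fun h => hi' h.1, zero_mul]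
  have hcard := hD.card_le hp x ?_ ?_
  · rw [Module.card_eq_pow_finrank (K := ZMod 2), ZMod.card,
      show 4 = 2 ^ 2 by norm_num, ← pow_mul] at hcard
    exact (Nat.pow_le_pow_iff_right (by norm_num)).1 hcard
  · intro w q hq
    simp only [x, decide_eq_false_iff_not]
    rintro ⟨j, hj, rfl, _⟩
    exact hp (hq.symm.trans (hC j hj))
  · intro w w' hww'
    ext i
    by_cases hi' : i ∈ R
    · have h1 := hww' (lo i) (hR i hi')
      rw [hout w i hi', hout w' i hi'] at h1
      have h2 : ∀ a b : ZMod 2, decide (a = 1) = decide (b = 1) → a = b := by decide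
      exact h2 _ _ h1
    · rw [hzero w i hi', hzero w' i hi']

/-- Some processor `p` and the other processor `p'` hold at least `h / 3` of the positions `lo`
and of the positions `hi`, respectively. -/
theorem IsBalanced.exists_processors {c : ℝ} {π : Fin n → Fin 2} (hπ : IsBalanced c π)
    {lo hi : Fin h → Fin n} (hlo : Function.Injective lo) (hhi : Function.Injective hi)
    (hd : ∀ i j, lo i ≠ hi j) (hn : n ≤ 2 * h + 1) (hc : 6 * c + 6 ≤ h) :
    ∃ p p' : Fin 2, p ≠ p' ∧ h / 3 ≤ (Finset.univ.filter fun i => π (lo i) = p).card ∧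
      h / 3 ≤ (Finset.univ.filter fun j => π (hi j) = p').card := by
  set R : Fin 2 → Finset (Fin h) := fun p => Finset.univ.filter fun i => π (lo i) = p with hR
  set C : Fin 2 → Finset (Fin h) := fun p => Finset.univ.filter fun j => π (hi j) = p with hC
  have hle : ∀ p, ((R p).card : ℝ) + (C p).card ≤ n / 2 + c := by
    intro p
    have h1 : (R p).card + (C p).card ≤ (Finset.univ.filter fun q => π q = p).card := by
      rw [← Finset.card_map ⟨lo, hlo⟩, ← Finset.card_map (s := C p) ⟨hi, hhi⟩,
        ← Finset.card_union_of_disjoint]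
      · refine Finset.card_le_card fun q hq => ?_
        simp only [hR, hC, Finset.mem_union, Finset.mem_map, Finset.mem_filter, Finset.mem_univ,
          true_and, Function.Embedding.coeFn_mk] at hq ⊢
        rcases hq with ⟨i, h2, rfl⟩ | ⟨j, h2, rfl⟩ <;> exact h2
      · rw [Finset.disjoint_left]
        simp only [Finset.mem_map, Function.Embedding.coeFn_mk]
        rintro q ⟨i, _, rfl⟩ ⟨j, _, h2⟩
        exact hd i j h2.symm
    have h2 := (abs_le.1 (hπ p)).2
    have h3 : ((R p).card : ℝ) + (C p).card ≤ (Finset.univ.filter fun q => π q = p).card := by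
      exact_mod_cast h1
    linarith
  have hsplit : ∀ f : Fin h → Fin n, ((Finset.univ.filter fun i => π (f i) = 0).card : ℝ) +
      (Finset.univ.filter fun i => π (f i) = 1).card = h := by
    intro f
    have h1 := Finset.card_filter_add_card_filter_not (s := (Finset.univ : Finset (Fin h)))
      fun i => π (f i) = 0
    have h2 : (Finset.univ.filter fun i => ¬ π (f i) = 0) =
        Finset.univ.filter fun i => π (f i) = 1 := by
      ext i
      simp only [Finset.mem_filter, Finset.mem_univ, true_and]
      omega
    rw [h2, Finset.card_univ, Fintype.card_fin] at h1
    exact_mod_cast h1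
  have h3 : ((h / 3 : ℕ) : ℝ) ≤ h / 3 := Nat.cast_div_le
  have hn' : (n : ℝ) ≤ 2 * h + 1 := by exact_mod_cast hn
  have hR' : ((R 0).card : ℝ) + (R 1).card = h := hsplit lo
  have hC' : ((C 0).card : ℝ) + (C 1).card = h := hsplit hi
  have h0 := hle 0
  have h1 := hle 1
  by_cases hbig : (h : ℝ) / 2 ≤ (R 0).card
  · refine ⟨0, 1, by decide, ?_, ?_⟩
    · have : ((h / 3 : ℕ) : ℝ) ≤ (R 0).card := by linarith
      exact_mod_cast this
    · have : ((h / 3 : ℕ) : ℝ) ≤ (C 1).card := by linarith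
      exact_mod_cast this
  · push Not at hbig
    refine ⟨1, 0, by decide, ?_, ?_⟩
    · have : ((h / 3 : ℕ) : ℝ) ≤ (R 1).card := by linarith
      exact_mod_cast this
    · have : ((h / 3 : ℕ) : ℝ) ≤ (C 0).card := by linarith
      exact_mod_cast this

/-- The hard CNOT circuits, with `h = n / 2`, `s = h / 3` and `r = h / 40` in the counting bound.
The constant `c` enters through the size of `n` only. -/
theorem exists_isCNOT_forall_le_cost (n : ℕ) :
    ∃ T : CliffordCircuit n, T.IsCNOT ∧ (200 ≤ n → ∀ c : ℝ, 6 * c + 6 ≤ (n / 2 : ℕ) →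
      ∀ π : Fin n → Fin 2, IsBalanced c π → ∀ (m : ℕ) (D : DistCircuit m π),
        D.Implements T.op → n / 2 / 40 < 2 * D.cost) := by
  by_cases hn : 200 ≤ n
  · obtain ⟨h, hh⟩ : ∃ h, h = n / 2 := ⟨_, rfl⟩
    rw [← hh]
    have hcount : 2 * h + 2 * (h * (h / 40)) < h / 3 * (h / 3) := by
      obtain ⟨s, hs⟩ : ∃ s, s = h / 3 := ⟨_, rfl⟩
      obtain ⟨r, hr⟩ : ∃ r, r = h / 40 := ⟨_, rfl⟩
      rw [← hs, ← hr]
      have h1 : h ≤ 3 * s + 2 := by omega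
      have h2 : 40 * r ≤ h := by omega
      have h3 : 33 ≤ s := by omega
      nlinarith [Nat.mul_le_mul_left h h2, Nat.mul_le_mul h1 h1]
    obtain ⟨N, hN⟩ := exists_forall_lt_finrank_range hcount
    have hlo : Function.Injective fun i : Fin h => (⟨i, by omega⟩ : Fin n) := fun i j hij =>
      Fin.ext (by simpa using hij)
    have hhi : Function.Injective fun i : Fin h => (⟨h + i, by omega⟩ : Fin n) := fun i j hij =>
      Fin.ext (by simpa using hij)
    have hd : ∀ i j : Fin h, (⟨i, by omega⟩ : Fin n) ≠ ⟨h + j, by omega⟩ := fun i j hij => by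
      have := congrArg Fin.val hij
      simp only at this
      omega
    obtain ⟨T, hT, hTop⟩ := exists_isCNOT_op_eq_shear hd N
    refine ⟨T, hT, fun _ c hc π hπ m D hD => ?_⟩
    rw [hTop] at hD
    obtain ⟨p, p', hp, hR, hC⟩ := hπ.exists_processors hlo hhi hd (by omega) hc
    exact (hN _ _ hR hC).trans_le (hD.finrank_le hlo hhi hd hp
      (fun i hi => (Finset.mem_filter.1 hi).2) fun j hj => (Finset.mem_filter.1 hj).2)
  · exact ⟨[], by simp [CliffordCircuit.IsCNOT], fun h => absurd h hn⟩

theorem mul_le_commComplexityUnbounded {n K k : ℕ} {c : ℝ} {U : QubitOp (Fin n)}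
    (hk : n ≤ K * k) (h : ∀ π : Fin n → Fin 2, IsBalanced c π → ∀ (m : ℕ) (D : DistCircuit m π),
      D.Implements U → k ≤ D.cost) :
    (n : ℕ∞) ≤ (K : ℕ∞) * commComplexityUnbounded c U := by
  have h1 : (k : ℕ∞) ≤ commComplexityUnbounded c U :=
    le_iInf fun m => le_iInf fun π => le_iInf fun D => by
      exact_mod_cast h π.1 π.2 m D.1 D.2
  calc (n : ℕ∞) ≤ (K : ℕ∞) * (k : ℕ∞) := by exact_mod_cast hk
    _ ≤ (K : ℕ∞) * commComplexityUnbounded c U := mul_le_mul_right h1 _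

end LowerBound

/-! ### The communication complexity of Clifford circuits -/

theorem mainTheorem4 :
    (∀ c : ℝ, 1 / 2 ≤ c → ∀ (n : ℕ) (T : CliffordCircuit n),
      commComplexity c 1 T.op ≤ 10 * (n : ℕ∞)) ∧
    (∃ K : ℕ, 0 < K ∧ ∃ T : (n : ℕ) → CliffordCircuit n, (∀ n : ℕ, (T n).IsCNOT) ∧
      ∀ c : ℝ, 1 / 2 ≤ c → ∃ N : ℕ, ∀ n : ℕ, N ≤ n →
        (n : ℕ∞) ≤ (K : ℕ∞) * commComplexityUnbounded c (T n).op) := by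
  -- the bound `4 * n` is stronger than required
  refine ⟨fun c hc n T => (commComplexity_op_le hc T).trans ?_, ?_⟩
  · gcongr
    norm_num
  · choose T hT hcost using exists_isCNOT_forall_le_cost
    refine ⟨160, by norm_num, T, hT, fun c _ => ⟨max 200 (2 * ⌈6 * c + 6⌉₊), fun n hn => ?_⟩⟩
    have h1 : 200 ≤ n := (le_max_left _ _).trans hn
    have h2 : ⌈6 * c + 6⌉₊ ≤ n / 2 := by
      have := (le_max_right _ _).trans hn
      omega
    refine mul_le_commComplexityUnbounded (k := (n / 2 / 40 + 2) / 2) (by omega)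
      fun π hπ m D hD => ?_
    have h3 := hcost n h1 c (Nat.ceil_le.1 h2) π hπ m D hD
    omega
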